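/- **Setting.** Let $(M,\lambda)$ denote a compact manifold without boundary of dimension $2n+1$ with a contact form ($\lambda\wedge(d\lambda)^n$ vanishes nowhere), with contact structure $\xi=\ker\lambda$ and Reeb vector field $X_\lambda$ ($\lambda(X_\lambda)=1$, $i_{X_\lambda}d\lambda=0$). A Legendrian submanifold of $M$ is an $n$-dimensional submanifold $\Lambda$ with $T\Lambda\subset\xi$. A Reeb chord from $\Lambda$ to $\Lambda'$ of length $T>0$ is a curve $\gamma:[0,T]\to M$ with $\dot\gamma=X_\lambda(\gamma)$, $\gamma(0)\in\Lambda$, $\gamma(T)\in\Lambda'$. Let $(X,\omega)$ be a symplectic manifold of dimension $2n+2$ which is the disjoint union of a compact set and of finitely many open subsets, each of which is a *concave end*, identified by a symplectic diffeomorphism with $((-\infty,R_-)\times M_-,\,d(e^{\alpha}\lambda_-))$, or a *convex end*, identified with $((R_+,\infty)\times M_+,\,d(e^{\alpha}\lambda_+))$. Here $\alpha$ is the $\mathbb R$-coordinate, $(M_\pm,\lambda_\pm)$ and $R_\pm\in\mathbb R$ may vary from end to end, and points of an end leave every compact subset of $X$ as $\alpha\to-\infty$ (concave) or $\alpha\to+\infty$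 (convex). Let $L_0,L_1\subset X$ be Lagrangian submanifolds which intersect transversally and which, on each concave end, are of the form $(-\infty,R_-)\times\Lambda_0^-$ and $(-\infty,R_-)\times\Lambda_1^-$ with $\Lambda_0^-,\Lambda_1^-\subset M_-$ Legendrian. Let $J_t$, $t\in[0,1]$, be a smooth family of almost complex structures on $X$ such that $\omega(\cdot,J_t\cdot)$ is a Riemannian metric. A *pseudo-holomorphic strip* is a smooth map $\overline u:\mathbb R\times[0,1]\to X$ with $$\frac{\partial\overline u}{\partial\tau}+J_t(\overline u)\frac{\partial\overline u}{\partial t}=0,\qquad \overline u(\mathbb R\times\{0\})\subset L_0,\quad \overline u(\mathbb R\times\{1\})\subset L_1,$$ which, uniformly in $t\in[0,1]$, satisfies one of the following two conditions as $\tau\to-\infty$: (a) $\overline u(\tau,\cdot)$ converges to a point of $L_0\cap L_1$; (b) $\overline u=(\alpha,u)$ enters a concave end, with $\alpha(\tau,t)\to-\infty$ and $u(\tau,t)\to\gamma(Tt)$ for a Reeb chord $\gamma$ from $\Lambda_0^-$ to $\Lambda_1^-$ of some length $T$; and one of the following two conditions as $\tau\to+\infty$: (a') $\overline u(\tau,\cdot)$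 converges to a point of $L_0\cap L_1$; (b') $\overline u=(\alpha,u)$ enters a concave end, with $\alpha(\tau,t)\to-\infty$ and $u(\tau,t)\to\gamma(T(1-t))$ for a Reeb chord $\gamma$ from $\Lambda_1^-$ to $\Lambda_0^-$ of some length $T$. **Lemma.** Let $(R,\infty)\times M_+$ be one of the convex ends of $X$. Suppose that on this end $L_0=(R,\infty)\times\Lambda_0^+$ and $L_1=(R,\infty)\times\Lambda_1^+$ with $\Lambda_0^+,\Lambda_1^+\subset M_+$ Legendrian, and that $J_t=\overline I_t$ on it, where $$\overline I_t\Big(a\frac{\partial}{\partial\alpha}+bX_{\lambda_+}+k\Big)=-b\frac{\partial}{\partial\alpha}+aX_{\lambda_+}+I_tk\qquad(a,b\in\mathbb R,\ k\in\xi_+)$$ for complex structures $I_t$ on $\xi_+$ such that $d\lambda_+(\cdot,I_t\cdot)$ is a positive definite inner product on $\xi_+$. Then the image of every pseudo-holomorphic strip $\overline u$ is contained in $X\setminus\big((R,\infty)\times M_+\big)$. -/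

import Mathlib

open Set Filter Topology
open scoped Manifold ContDiff

noncomputable section

namespace FloerEnds

universe u

/-! ### Differential forms on manifolds without boundary -/

section Forms

variable {E : Type*} [NormedAddCommGroup E] [NormedSpace ℝ E]
  {H : Type*} [TopologicalSpace H] (I : ModelWithCorners ℝ E H)
  (X : Type*) [TopologicalSpace X] [ChartedSpace H X]

/-- A (not necessarily smooth) differential `k`-form on the manifold `X`. -/
abbrev DForm (k : ℕ) : Type _ := ∀ x : X, TangentSpace I x [⋀^Fin k]→L[ℝ] ℝ

end Forms

namespace DForm

variable {E : Type*} [NormedAddCommGroup E] [NormedSpace ℝ E]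
  {H : Type*} [TopologicalSpace H] {I : ModelWithCorners ℝ E H}
  {X : Type*} [TopologicalSpace X] [ChartedSpace H X]
  {E' : Type*} [NormedAddCommGroup E'] [NormedSpace ℝ E']
  {H' : Type*} [TopologicalSpace H'] {I' : ModelWithCorners ℝ E' H'}
  {Y : Type*} [TopologicalSpace Y] [ChartedSpace H' Y]
  {k : ℕ}

/-- The pull-back `f^* Ω`. -/
def pullback (f : Y → X) (Ω : DForm I X k) : DForm I' Y k := fun y =>
  (Ω (f y)).compContinuousLinearMap (mfderiv I' I f y)

/-- The expression of a form in the preferred chart at `x₀`; only its values on the target of that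
chart are meaningful. -/
def inChart (Ω : DForm I X k) (x₀ : X) : E → E [⋀^Fin k]→L[ℝ] ℝ := fun y =>
  (Ω ((extChartAt I x₀).symm y)).compContinuousLinearMap
    (mfderiv 𝓘(ℝ, E) I (extChartAt I x₀).symm y)

/-- A form is smooth if its coefficients are smooth in the charts. -/
def IsSmooth (Ω : DForm I X k) : Prop :=
  ∀ x₀ : X, ContDiffOn ℝ ∞ (Ω.inChart x₀) (extChartAt I x₀).target

/-- The exterior derivative, computed at each point in the preferred chart there. -/
def d (Ω : DForm I X k) : DForm I X (k + 1) := fun x =>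
  (extDeriv (Ω.inChart x) (extChartAt I x x)).compContinuousLinearMap
    (mfderiv I 𝓘(ℝ, E) (extChartAt I x) x)

/-- A symplectic form: smooth, closed and non-degenerate. -/
structure IsSymplectic (Ω : DForm I X 2) : Prop where
  smooth : Ω.IsSmooth
  closed : ∀ x, Ω.d x = 0
  nondegenerate : ∀ (x : X) (v : TangentSpace I x),
    (∀ w : TangentSpace I x, Ω x ![v, w] = 0) → v = 0

end DForm

/-! ### Wedge products of real-valued alternating maps -/

section Wedge

variable {V : Type*} [AddCommGroup V] [Module ℝ V]

/-- The wedge product (a sum over shuffles). -/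
def wedge {p q : ℕ} (a : V [⋀^Fin p]→ₗ[ℝ] ℝ) (b : V [⋀^Fin q]→ₗ[ℝ] ℝ) :
    V [⋀^Fin (p + q)]→ₗ[ℝ] ℝ :=
  ((LinearMap.mul' ℝ ℝ).compAlternatingMap (a.domCoprod b)).domDomCongr finSumFinEquiv

/-- The wedge power `b ∧ ⋯ ∧ b` (`n` factors) of a `2`-form. -/
def wedgePow (b : V [⋀^Fin 2]→ₗ[ℝ] ℝ) : (n : ℕ) → V [⋀^Fin (2 * n)]→ₗ[ℝ] ℝ
  | 0 => haveI : IsEmpty (Fin (2 * 0)) := inferInstanceAs (IsEmpty (Fin 0))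
    AlternatingMap.constOfIsEmpty ℝ V (Fin (2 * 0)) 1
  | n + 1 => wedge (wedgePow b n) b

theorem wedge_eq_zero {p q : ℕ} {a : V [⋀^Fin p]→ₗ[ℝ] ℝ} {b : V [⋀^Fin q]→ₗ[ℝ] ℝ} {w : V}
    (ha : ∀ v i, v i = w → a v = 0) (hb : ∀ v i, v i = w → b v = 0) :
    ∀ v i, v i = w → wedge a b v = 0 := by
  intro v i hi
  simp only [wedge, AlternatingMap.domDomCongr_apply, LinearMap.compAlternatingMap_apply]
  rw [AlternatingMap.domCoprod_apply]
  rw [sum_apply, map_sum]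
  refine Finset.sum_eq_zero fun σ _ => ?_
  induction σ using Quotient.inductionOn' with
  | h σ =>
    rw [AlternatingMap.domCoprod.summand_mk'']
    simp only [smul_apply, MultilinearMap.domDomCongr_apply,
      MultilinearMap.domCoprod_apply]
    rw [map_zsmul_unit]
    obtain ⟨j, hj⟩ := σ.surjective (finSumFinEquiv.symm i)
    cases j with
    | inl j =>
      have : a (fun i₁ => (v ∘ finSumFinEquiv) (σ (Sum.inl i₁))) = 0 :=
        ha _ j (by simp [hj, hi])
      simp at this
      simp [this]
    | inr j =>
      have : b (fun i₁ => (v ∘ finSumFinEquiv) (σ (Sum.inr i₁))) = 0 :=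
        hb _ j (by simp [hj, hi])
      simp at this
      simp [this]

theorem wedgePow_eq_zero {b : V [⋀^Fin 2]→ₗ[ℝ] ℝ} {w : V}
    (hb : ∀ v i, v i = w → b v = 0) (n : ℕ) : ∀ v i, v i = w → wedgePow b n v = 0 := by
  induction n with
  | zero => intro v i; exact i.elim0
  | succ n ih => exact wedge_eq_zero ih hb

end Wedge

/-! ### Submanifolds -/

section Submanifolds

variable (m : ℕ) {X : Type*} [TopologicalSpace X] [ChartedSpace (EuclideanSpace ℝ (Fin m)) X]

/-- `L` is an embedded submanifold of dimension `k`: around each of its points there is a chart of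
`X` in which `L` is an affine subspace of dimension `k`. -/
def IsSubmanifold (k : ℕ) (L : Set X) : Prop :=
  ∀ x ∈ L, ∃ e ∈ IsManifold.maximalAtlas (𝓡 m) ∞ X, x ∈ e.source ∧
    ∃ W : Submodule ℝ (EuclideanSpace ℝ (Fin m)), Module.finrank ℝ W = k ∧
      ∀ y ∈ e.source, (y ∈ L ↔ e y - e x ∈ W)

/-- `v ∈ T_x X` is tangent to `L`: it is the velocity at `x` of a smooth curve in `L`. -/
def IsTangentTo (L : Set X) (x : X) (v : TangentSpace (𝓡 m) x) : Prop :=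
  ∃ c : ℝ → X, c 0 = x ∧ (∀ᶠ s in 𝓝 0, c s ∈ L) ∧ ContMDiffAt 𝓘(ℝ, ℝ) (𝓡 m) ∞ c 0 ∧
    HasMFDerivAt 𝓘(ℝ, ℝ) (𝓡 m) c 0 (ContinuousLinearMap.toSpanSingleton ℝ v)

/-- Transversality: `T_x L₀ + T_x L₁ = T_x X` for all `x ∈ L₀ ∩ L₁`. -/
def Transversal (L₀ L₁ : Set X) : Prop :=
  ∀ x ∈ L₀ ∩ L₁, ∀ v : TangentSpace (𝓡 m) x,
    ∃ v₀ v₁ : TangentSpace (𝓡 m) x, IsTangentTo m L₀ x v₀ ∧ IsTangentTo m L₁ x v₁ ∧ v = v₀ + v₁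

end Submanifolds

/-- A Lagrangian submanifold of a symplectic manifold of dimension `2 k`. -/
structure IsLagrangian {k : ℕ} {X : Type*} [TopologicalSpace X]
    [ChartedSpace (EuclideanSpace ℝ (Fin (2 * k))) X] (Ω : DForm (𝓡 (2 * k)) X 2) (L : Set X) :
    Prop where
  submanifold : IsSubmanifold (2 * k) k L
  isotropic : ∀ x ∈ L, ∀ v w : TangentSpace (𝓡 (2 * k)) x,
    IsTangentTo (2 * k) L x v → IsTangentTo (2 * k) L x w → Ω x ![v, w] = 0

/-! ### Contact manifolds -/

/-- A compact manifold (without boundary) of dimension `2 n + 1` with a contact form `λ`, that is,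
a smooth `1`-form such that `λ ∧ (dλ)^n` vanishes nowhere. -/
structure ContactManifold (n : ℕ) : Type (u + 1) where
  carrier : Type u
  [topologicalSpace : TopologicalSpace carrier]
  [chartedSpace : ChartedSpace (EuclideanSpace ℝ (Fin (2 * n + 1))) carrier]
  [isManifold : IsManifold (𝓡 (2 * n + 1)) ∞ carrier]
  [t2Space : T2Space carrier]
  [compactSpace : CompactSpace carrier]
  form : DForm (𝓡 (2 * n + 1)) carrier 1
  smooth : form.IsSmooth
  contact : ∀ x, wedge (form x).toAlternatingMap (wedgePow (form.d x).toAlternatingMap n) ≠ 0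

namespace ContactManifold

instance {n : ℕ} : CoeSort (ContactManifold.{u} n) (Type u) := ⟨carrier⟩

attribute [instance] topologicalSpace chartedSpace isManifold t2Space compactSpace

variable {n : ℕ} (M : ContactManifold.{u} n)

/-- `v` satisfies the equations `λ(v) = 1`, `i_v dλ = 0` of the Reeb vector field at `x`. -/
def IsReebVector (x : M) (v : TangentSpace (𝓡 (2 * n + 1)) x) : Prop :=
  M.form x ![v] = 1 ∧ ∀ w : TangentSpace (𝓡 (2 * n + 1)) x, M.form.d x ![v, w] = 0

variable {M} in
theorem eq_zero_of_form_eq_zero {x : M} {v : TangentSpace (𝓡 (2 * n + 1)) x}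
    (h₁ : M.form x ![v] = 0) (h₂ : ∀ w, M.form.d x ![v, w] = 0) : v = 0 := by
  by_contra hv
  have hd : Module.finrank ℝ (TangentSpace (𝓡 (2 * n + 1)) x) = 2 * n + 1 := by
    change Module.finrank ℝ (EuclideanSpace ℝ (Fin (2 * n + 1))) = _
    simp
  have ha : ∀ z i, z i = v → (M.form x).toAlternatingMap z = 0 := by
    intro z i hz
    have : z = ![v] := by ext j; rw [← hz, Subsingleton.elim j i]; simp
    rw [this]; exact h₁
  have hb : ∀ z i, z i = v → (M.form.d x).toAlternatingMap z = 0 := by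
    intro z i hz
    have hz2 : z = ![z 0, z 1] := by ext j; fin_cases j <;> rfl
    fin_cases i
    · have : z 0 = v := hz
      rw [hz2, this]; exact h₂ _
    · have : z 1 = v := hz
      have hs := (M.form.d x).toAlternatingMap.map_swap z (i := 0) (j := 1) (by decide)
      have h0 : (M.form.d x).toAlternatingMap (z ∘ Equiv.swap 0 1) = 0 := by
        have : z ∘ Equiv.swap (0 : Fin 2) 1 = ![v, z 0] := by
          ext j; fin_cases j <;> simp [this]
        rw [this]; exact h₂ _
      rw [h0] at hs
      linarith
  have hw := wedge_eq_zero ha (wedgePow_eq_zero hb n)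
  apply M.contact x
  -- complete `v` to a basis
  have hli : LinearIndepOn ℝ id ({v} : Set (TangentSpace (𝓡 (2 * n + 1)) x)) := by
    simpa using (LinearIndepOn.singleton (R := ℝ) (v := id) hv)
  let B := Module.Basis.extend hli
  have hvB : v ∈ hli.extend (subset_univ _) := hli.subset_extend _ rfl
  have : FiniteDimensional ℝ (TangentSpace (𝓡 (2 * n + 1)) x) :=
    inferInstanceAs (FiniteDimensional ℝ (EuclideanSpace ℝ (Fin (2 * n + 1))))
  have : Fintype (hli.extend (subset_univ _)) := FiniteDimensional.fintypeBasisIndex B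
  have hc : Fintype.card (hli.extend (subset_univ _)) = 1 + 2 * n := by
    rw [← Module.finrank_eq_card_basis B, hd, add_comm]
  let e := Fintype.equivFinOfCardEq hc
  let B' := B.reindex e
  refine AlternatingMap.ext fun z => ?_
  have h1 := AlternatingMap.eq_smul_basis_det B'
    (wedge (M.form x).toAlternatingMap (wedgePow (M.form.d x).toAlternatingMap n))
  have h2 : wedge (M.form x).toAlternatingMap (wedgePow (M.form.d x).toAlternatingMap n) B' = 0 :=
    hw _ (e ⟨v, hvB⟩) (by simp [B', B])
  rw [h1, h2]; simp

/-- The equations of the Reeb vector field have exactly one solution at each point. -/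
theorem existsUnique_isReebVector (x : M) : ∃! v, M.IsReebVector x v := by
  let T := TangentSpace (𝓡 (2 * n + 1)) x
  let ω' := (M.form.d x).toAlternatingMap
  let l : T → ℝ := fun v => M.form x ![v]
  have l_smul : ∀ (c : ℝ) (v : T), l (c • v) = c * l v := fun c v =>
    (M.form x).toAlternatingMap.map_vecCons_smul ![] c v
  have l_add : ∀ v w : T, l (v + w) = l v + l w := fun v w =>
    (M.form x).toAlternatingMap.map_vecCons_add ![] v w
  have anti : ∀ v w : T, ω' ![w, v] = -ω' ![v, w] := fun v w => by
    have hs := ω'.map_swap ![v, w] (i := 0) (j := 1) (by decide)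
    have : (![v, w] : Fin 2 → T) ∘ Equiv.swap (0 : Fin 2) 1 = ![w, v] := by
      ext j; fin_cases j <;> simp
    rwa [this] at hs
  have b_smul : ∀ (c : ℝ) (v w : T), ω' ![c • v, w] = c * ω' ![v, w] := fun c v w =>
    ω'.map_vecCons_smul ![w] c v
  have b_add : ∀ v v' w : T, ω' ![v + v', w] = ω' ![v, w] + ω' ![v', w] := fun v v' w =>
    ω'.map_vecCons_add ![w] v v'
  let β : T →ₗ[ℝ] T →ₗ[ℝ] ℝ := LinearMap.mk₂ ℝ (fun v w => ω' ![v, w]) b_add b_smul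
    (fun v w w' => by simp only [anti _ v, b_add]; ring)
    (fun c v w => by rw [anti, b_smul, anti w v]; simp)
  have β_apply : ∀ v w, β v w = ω' ![v, w] := fun _ _ => rfl
  -- a skew form on an odd-dimensional space has a kernel
  let b : Module.Basis (Fin (2 * n + 1)) ℝ T :=
    (EuclideanSpace.basisFun (Fin (2 * n + 1)) ℝ).toBasis
  let A : Matrix (Fin (2 * n + 1)) (Fin (2 * n + 1)) ℝ := Matrix.of fun i j => β (b j) (b i)
  have hA : A.transpose = -A := by
    ext i j
    simp only [A, Matrix.transpose_apply, Matrix.of_apply, Matrix.neg_apply, β_apply]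
    exact anti _ _
  have hdet : A.det = 0 := by
    have h := congrArg Matrix.det hA
    rw [Matrix.det_transpose, Matrix.det_neg, Fintype.card_fin, pow_succ, pow_mul] at h
    norm_num at h
    linarith
  obtain ⟨c, hc, hAc⟩ := Matrix.exists_mulVec_eq_zero_iff.mpr hdet
  let v : T := ∑ j, c j • b j
  have hv : v ≠ 0 := fun h => hc (by
    ext j
    exact (Fintype.linearIndependent_iff.mp b.linearIndependent c h j))
  have hβ : β v = 0 := b.ext fun i => by
    have := congrFun hAc i
    simp only [Matrix.mulVec, dotProduct, A, Matrix.of_apply, Pi.zero_apply] at this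
    simp only [v, map_sum, map_smul, smul_eq_mul,
      LinearMap.zero_apply, LinearMap.sum_apply, LinearMap.smul_apply]
    rw [← this]
    exact Finset.sum_congr rfl fun j _ => mul_comm _ _
  have hker : ∀ w : T, ω' ![v, w] = 0 := fun w => by rw [← β_apply, hβ]; rfl
  have hl : l v ≠ 0 := fun h => hv (eq_zero_of_form_eq_zero h hker)
  refine ⟨(l v)⁻¹ • v, ⟨?_, fun w => ?_⟩, ?_⟩
  · have := l_smul (l v)⁻¹ v
    rw [inv_mul_cancel₀ hl] at this
    exact this
  · have := b_smul (l v)⁻¹ v w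
    rw [hker, mul_zero] at this
    exact this
  · rintro w ⟨hw₁, hw₂⟩
    have e : w = ((l v)⁻¹ • v : T) + (w + (-1 : ℝ) • ((l v)⁻¹ • v : T)) := by
      module
    have z : (w + (-1 : ℝ) • ((l v)⁻¹ • v : T)) = 0 := by
      apply eq_zero_of_form_eq_zero
      · have h1 := l_add w ((-1 : ℝ) • ((l v)⁻¹ • v : T))
        rw [l_smul, l_smul, inv_mul_cancel₀ hl, show l w = 1 from hw₁] at h1
        exact h1.trans (by norm_num)
      · intro y
        have h1 := b_add w ((-1 : ℝ) • ((l v)⁻¹ • v : T)) y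
        rw [b_smul, b_smul, hker, show ω' ![w, y] = 0 from hw₂ y] at h1
        exact h1.trans (by norm_num)
    rw [z, add_zero] at e
    exact e

/-- The Reeb vector field. -/
def reeb (x : M) : TangentSpace (𝓡 (2 * n + 1)) x :=
  (M.existsUnique_isReebVector x).choose

theorem isReebVector_reeb (x : M) : M.IsReebVector x (M.reeb x) :=
  (M.existsUnique_isReebVector x).choose_spec.1

/-- The contact structure `ξ = ker λ`. -/
def xi (x : M) : Submodule ℝ (TangentSpace (𝓡 (2 * n + 1)) x) where
  carrier := {v | M.form x ![v] = 0}
  zero_mem' := (M.form x).map_coord_zero 0 rfl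
  add_mem' := fun {v w} hv hw => by
    have h : M.form x ![v + w] = M.form x ![v] + M.form x ![w] :=
      (M.form x).toAlternatingMap.map_vecCons_add ![] v w
    change M.form x ![v] = 0 at hv; change M.form x ![w] = 0 at hw; change M.form x ![v + w] = 0
    rw [h, hv, hw, add_zero]
  smul_mem' := fun c v hv => by
    have h : M.form x ![c • v] = c • M.form x ![v] :=
      (M.form x).toAlternatingMap.map_vecCons_smul ![] c v
    change M.form x ![v] = 0 at hv; change M.form x ![c • v] = 0
    rw [h, hv, smul_zero]

/-- A Legendrian submanifold: dimension `n` and `TΛ ⊆ ξ`. -/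
structure IsLegendrian (Λ : Set M) : Prop where
  submanifold : IsSubmanifold (2 * n + 1) n Λ
  tangent_le : ∀ x ∈ Λ, ∀ v : TangentSpace (𝓡 (2 * n + 1)) x,
    IsTangentTo (2 * n + 1) Λ x v → v ∈ M.xi x

/-- A Reeb chord `c : [0, T] → M` from `Λ` to `Λ'` (of length `T > 0`). -/
structure IsReebChord (Λ Λ' : Set M) (T : ℝ) (c : ℝ → M) : Prop where
  pos : 0 < T
  hasDeriv : ∀ s ∈ Icc 0 T, HasMFDerivWithinAt 𝓘(ℝ, ℝ) (𝓡 (2 * n + 1)) c (Icc 0 T) s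
    (ContinuousLinearMap.toSpanSingleton ℝ (M.reeb (c s)))
  start_mem : c 0 ∈ Λ
  end_mem : c T ∈ Λ'

/-- The symplectic form `d(e^α λ)` of the symplectization `ℝ × M`, where `α` is the coordinate
on `ℝ`. -/
def symplectizationForm : DForm (𝓘(ℝ, ℝ).prod (𝓡 (2 * n + 1))) (ℝ × M) 2 :=
  DForm.d (fun p => Real.exp p.1 • DForm.pullback (Prod.snd : ℝ × M → M) M.form p)

/-- A complex structure `I` on `ξ` for which `dλ(h, I k)` is a positive definite inner product. -/
structure IsCompatibleOnXi (I : ∀ x : M, M.xi x →ₗ[ℝ] M.xi x) : Prop where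
  sq_eq : ∀ x k, I x (I x k) = -k
  symm : ∀ x (h k : M.xi x), M.form.d x ![h.1, (I x k).1] = M.form.d x ![k.1, (I x h).1]
  pos : ∀ x (k : M.xi x), k ≠ 0 → 0 < M.form.d x ![k.1, (I x k).1]

end ContactManifold

/-! ### Symplectic manifolds with cylindrical ends -/

section Ends

variable {n : ℕ} {X : Type*} [TopologicalSpace X]
  [ChartedSpace (EuclideanSpace ℝ (Fin (2 * (n + 1)))) X]

/-- An end of `(X, Ω)` which is symplectically isomorphic to the part `S × M` of the
symplectization of `M`. Being an end, it leaves every compact set of `X` as the coordinate on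
`S ⊆ ℝ` tends to infinity along `l`. -/
structure CylindricalEnd (Ω : DForm (𝓡 (2 * (n + 1))) X 2) (M : ContactManifold.{u} n)
    (S : Set ℝ) (l : Filter ℝ) where
  /-- the identification of `S × M` with an open subset of `X` -/
  chart : OpenPartialHomeomorph (ℝ × M) X
  source_eq : chart.source = S ×ˢ univ
  smooth : ContMDiffOn (𝓘(ℝ, ℝ).prod (𝓡 (2 * n + 1))) (𝓡 (2 * (n + 1))) ∞ chart chart.source
  smooth_symm : ContMDiffOn (𝓡 (2 * (n + 1))) (𝓘(ℝ, ℝ).prod (𝓡 (2 * n + 1))) ∞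
    chart.symm chart.target
  symplectic : ∀ p ∈ chart.source, DForm.pullback chart Ω p = M.symplectizationForm p
  proper : Tendsto chart (l ×ˢ ⊤) (cocompact X)

/-- A concave end `(-∞, R) × M`. -/
abbrev ConcaveEnd (Ω : DForm (𝓡 (2 * (n + 1))) X 2) (M : ContactManifold.{u} n) (R : ℝ) :=
  CylindricalEnd Ω M (Iio R) atBot

/-- A convex end `(R, ∞) × M`. -/
abbrev ConvexEnd (Ω : DForm (𝓡 (2 * (n + 1))) X 2) (M : ContactManifold.{u} n) (R : ℝ) :=
  CylindricalEnd Ω M (Ioi R) atTop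

/-- A decomposition of `X` into a compact set and finitely many disjoint concave and convex
ends. -/
structure Ends (Ω : DForm (𝓡 (2 * (n + 1))) X 2) where
  /-- the labels of the concave ends -/
  Neg : Type
  /-- the labels of the convex ends -/
  Pos : Type
  [finite_neg : Finite Neg]
  [finite_pos : Finite Pos]
  MNeg : Neg → ContactManifold.{u} n
  MPos : Pos → ContactManifold.{u} n
  RNeg : Neg → ℝ
  RPos : Pos → ℝ
  concave : ∀ j, ConcaveEnd Ω (MNeg j) (RNeg j)
  convex : ∀ i, ConvexEnd Ω (MPos i) (RPos i)
  disjoint_neg : ∀ j j', j ≠ j' → Disjoint (concave j).chart.target (concave j').chart.target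
  disjoint_pos : ∀ i i', i ≠ i' → Disjoint (convex i).chart.target (convex i').chart.target
  disjoint : ∀ j i, Disjoint (concave j).chart.target (convex i).chart.target
  compact_core :
    IsCompact ((⋃ j, (concave j).chart.target) ∪ ⋃ i, (convex i).chart.target)ᶜ

variable {Ω : DForm (𝓡 (2 * (n + 1))) X 2} {M : ContactManifold.{u} n} {S : Set ℝ} {l : Filter ℝ}

/-- On the end, `L` is the cylinder `S × Λ`. -/
def CylindricalEnd.IsCylinderOver (e : CylindricalEnd Ω M S l) (L : Set X) (Λ : Set M) : Prop :=
  ∀ p ∈ e.chart.source, (e.chart p ∈ L ↔ p.2 ∈ Λ)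

/-- A time-dependent endomorphism field `J_t` of `TX`; only `t ∈ [0, 1]` matters. -/
abbrev TimeDependentEndo (n : ℕ) (X : Type*) [TopologicalSpace X]
    [ChartedSpace (EuclideanSpace ℝ (Fin (2 * (n + 1)))) X] : Type _ :=
  ℝ → ∀ x : X, TangentSpace (𝓡 (2 * (n + 1))) x →L[ℝ] TangentSpace (𝓡 (2 * (n + 1))) x

/-- The expression of `J` in the preferred chart at `x₀`, as a function of time and of the point;
only its values on the target of that chart are meaningful. -/
def TimeDependentEndo.inChart (J : TimeDependentEndo n X) (x₀ : X) :
    ℝ × EuclideanSpace ℝ (Fin (2 * (n + 1))) →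
      EuclideanSpace ℝ (Fin (2 * (n + 1))) →L[ℝ] EuclideanSpace ℝ (Fin (2 * (n + 1))) := fun p =>
  (mfderiv (𝓡 (2 * (n + 1))) 𝓘(ℝ, EuclideanSpace ℝ (Fin (2 * (n + 1))))
      (extChartAt (𝓡 (2 * (n + 1))) x₀) ((extChartAt (𝓡 (2 * (n + 1))) x₀).symm p.2)).comp
    ((J p.1 ((extChartAt (𝓡 (2 * (n + 1))) x₀).symm p.2)).comp
      (mfderiv 𝓘(ℝ, EuclideanSpace ℝ (Fin (2 * (n + 1)))) (𝓡 (2 * (n + 1)))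
        (extChartAt (𝓡 (2 * (n + 1))) x₀).symm p.2))

/-- `J_t`, `t ∈ [0, 1]`, is a smooth family of almost complex structures such that `Ω(·, J_t ·)` is
a Riemannian metric. -/
structure IsCompatibleFamily (Ω : DForm (𝓡 (2 * (n + 1))) X 2) (J : TimeDependentEndo n X) :
    Prop where
  smooth : ∀ x₀ : X, ContDiffOn ℝ ∞ (TimeDependentEndo.inChart J x₀)
    (Icc (0 : ℝ) 1 ×ˢ (extChartAt (𝓡 (2 * (n + 1))) x₀).target)
  sq_eq : ∀ t ∈ Icc (0 : ℝ) 1, ∀ x v, J t x (J t x v) = -v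
  symm : ∀ t ∈ Icc (0 : ℝ) 1, ∀ (x : X) (v w : TangentSpace (𝓡 (2 * (n + 1))) x),
    Ω x ![v, J t x w] = Ω x ![w, J t x v]
  pos : ∀ t ∈ Icc (0 : ℝ) 1, ∀ (x : X) (v : TangentSpace (𝓡 (2 * (n + 1))) x),
    v ≠ 0 → 0 < Ω x ![v, J t x v]

/-- On the end, `J_t` is of the form `Ī_t` for compatible complex structures `I_t` on `ξ`:
`Ī_t (a ∂_α + b X_λ + k) = -b ∂_α + a X_λ + I_t k` for `a, b ∈ ℝ` and `k ∈ ξ`. -/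
def CylindricalEnd.IsCylindricalFamily (e : CylindricalEnd Ω M S l) (J : TimeDependentEndo n X) :
    Prop :=
  ∃ I : ℝ → ∀ x : M, M.xi x →ₗ[ℝ] M.xi x,
    (∀ t ∈ Icc (0 : ℝ) 1, M.IsCompatibleOnXi (I t)) ∧
    ∀ t ∈ Icc (0 : ℝ) 1, ∀ p ∈ e.chart.source, ∀ (a b : ℝ) (k : M.xi p.2),
      let D : ℝ × TangentSpace (𝓡 (2 * n + 1)) p.2 →L[ℝ]
          TangentSpace (𝓡 (2 * (n + 1))) (e.chart p) :=
        mfderiv (𝓘(ℝ, ℝ).prod (𝓡 (2 * n + 1))) (𝓡 (2 * (n + 1))) e.chart p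
      J t (e.chart p) (D (a, b • M.reeb p.2 + k)) = D (-b, a • M.reeb p.2 + I t p.2 k)

/-! ### Pseudo-holomorphic strips -/

/-- The strip `ℝ × [0, 1]`, with coordinates `(τ, t)`. -/
def strip : Set (ℝ × ℝ) := univ ×ˢ Icc 0 1

/-- `u(τ, [0, 1])` converges to the point `p` as `τ` tends to `±∞` along `s`. -/
def TendstoPoint (u : ℝ × ℝ → X) (s : Filter ℝ) (p : X) : Prop :=
  Tendsto u (s ×ˢ 𝓟 (Icc 0 1)) (𝓝 p)

/-- As `τ` tends to `±∞` along `s`, the map `u = (α, v)` enters the end, `α` tends to infinity along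
`l` and `v(τ, t)` tends to `c t`, everything uniformly in `t ∈ [0, 1]`. -/
structure CylindricalEnd.TendstoCurve (e : CylindricalEnd Ω M S l) (u : ℝ × ℝ → X) (s : Filter ℝ)
    (c : ℝ → M) : Prop where
  eventually_mem : ∀ᶠ z in s ×ˢ 𝓟 (Icc 0 1), u z ∈ e.chart.target
  tendsto_fst : Tendsto (fun z => (e.chart.symm (u z)).1) (s ×ˢ 𝓟 (Icc 0 1)) l
  tendsto_snd : ∀ t ∈ Icc (0 : ℝ) 1,
    Tendsto (fun z => (e.chart.symm (u z)).2) (s ×ˢ 𝓝[Icc 0 1] t) (𝓝 (c t))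

variable (𝓔 : Ends.{u} Ω) (L₀ L₁ : Set X) (Λ₀ Λ₁ : ∀ j, Set (𝓔.MNeg j)) (u : ℝ × ℝ → X)

/-- At `τ → -∞`, the map `u` converges to a point of `L₀ ∩ L₁`. -/
def PointAtBot : Prop := ∃ p ∈ L₀ ∩ L₁, TendstoPoint u atBot p

/-- At `τ → +∞`, the map `u` converges to a point of `L₀ ∩ L₁`. -/
def PointAtTop : Prop := ∃ p ∈ L₀ ∩ L₁, TendstoPoint u atTop p

/-- At `τ → -∞`, the map `u` is asymptotic, at `-∞` of a concave end, to `γ(T t)` for a Reeb chord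
`γ` from `Λ₀` to `Λ₁` of length `T`. -/
def ChordAtBot : Prop :=
  ∃ (j : 𝓔.Neg) (T : ℝ) (γ : ℝ → 𝓔.MNeg j), (𝓔.MNeg j).IsReebChord (Λ₀ j) (Λ₁ j) T γ ∧
    (𝓔.concave j).TendstoCurve u atBot (fun t => γ (T * t))

/-- At `τ → +∞`, the map `u` is asymptotic, at `-∞` of a concave end, to `γ(T (1 - t))` for a Reeb
chord `γ` from `Λ₁` to `Λ₀` of length `T`. -/
def ChordAtTop : Prop :=
  ∃ (j : 𝓔.Neg) (T : ℝ) (γ : ℝ → 𝓔.MNeg j), (𝓔.MNeg j).IsReebChord (Λ₁ j) (Λ₀ j) T γ ∧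
    (𝓔.concave j).TendstoCurve u atTop (fun t => γ (T * (1 - t)))

/-- Pseudo-holomorphic strips in `X` with boundary on `L₀` and `L₁`. On the concave ends, `L₀` and
`L₁` are the cylinders over `Λ₀` and `Λ₁`. -/
structure IsPseudoholomorphicStrip (J : TimeDependentEndo n X) : Prop where
  smooth : ContMDiffOn 𝓘(ℝ, ℝ × ℝ) (𝓡 (2 * (n + 1))) ∞ u strip
  /-- the equation `∂u/∂τ + J_t(u) ∂u/∂t = 0` -/
  equation : ∀ z ∈ strip,
    mfderivWithin 𝓘(ℝ, ℝ × ℝ) (𝓡 (2 * (n + 1))) u strip z ((1, 0) : ℝ × ℝ) +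
      J z.2 (u z) (mfderivWithin 𝓘(ℝ, ℝ × ℝ) (𝓡 (2 * (n + 1))) u strip z ((0, 1) : ℝ × ℝ)) = 0
  boundary₀ : ∀ τ, u (τ, 0) ∈ L₀
  boundary₁ : ∀ τ, u (τ, 1) ∈ L₁
  /-- at each of `τ → ±∞`, an intersection point or a Reeb chord -/
  asymptotics :
    (PointAtBot L₀ L₁ u ∧ PointAtTop L₀ L₁ u) ∨
    (ChordAtBot 𝓔 Λ₀ Λ₁ u ∧ PointAtTop L₀ L₁ u) ∨
    (PointAtBot L₀ L₁ u ∧ ChordAtTop 𝓔 Λ₀ Λ₁ u) ∨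
    (ChordAtBot 𝓔 Λ₀ Λ₁ u ∧ ChordAtTop 𝓔 Λ₀ Λ₁ u)

end Ends

end FloerEnds

end

namespace FloerEnds

universe u

/-! ### A maximum principle on the strip -/

/-! The height `α` of a strip above the convex end obeys a maximum principle. Write the strip there
as `(α, m)`. The equation splits into `∂α/∂τ = λ(∂m/∂t)`, `∂α/∂t = -λ(∂m/∂τ)` and a `ξ`-part that
makes `dλ(∂m/∂τ, ∂m/∂t)` nonnegative (`equation_components`). Differentiating the first two
relations gives `Δα = dλ(∂m/∂τ, ∂m/∂t) ≥ 0`. On `t = 0, 1` the curve `m` runs in a Legendrian, so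
`∂α/∂t = -λ(∂m/∂τ) = 0`: subharmonic with Neumann boundary condition.

If the strip reached height above some `c > R`, the part of it at height `≥ c` would be compact
(`isCompact_preimage`). Indeed, chords at `τ → ±∞` lie in concave ends, and no point of `L₀ ∩ L₁`
lies in this convex end, because two Legendrian cylinders are never transverse
(`disjoint_of_transversal`). A maximum of `α` above `c` is then reached away from the level `c`.

Such a maximum is excluded without the strong maximum principle or Hopf's lemma
(`le_of_subharmonic_neumann`): adding a small multiple of a quadratic function makes both the
Laplacian and the inward normal derivative strictly positive, and then elementary first and second
derivative tests suffice. -/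

theorem strip_mem_nhds {z : ℝ × ℝ} (hz : z.2 ∈ Ioo (0 : ℝ) 1) : strip ∈ 𝓝 z := by
  have : strip = Prod.snd ⁻¹' Icc (0 : ℝ) 1 := by ext; simp [strip]
  rw [this]
  exact continuous_snd.continuousAt (Icc_mem_nhds hz.1 hz.2)

/-- A positive second derivative would make `x` a local minimum as well, hence `f` locally constant,
with second derivative zero. -/
theorem deriv_deriv_nonpos_of_isLocalMax {f : ℝ → ℝ} {x : ℝ} (hc : ContinuousAt f x)
    (hf : IsLocalMax f x) : deriv (deriv f) x ≤ 0 := by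
  by_contra! h
  have hmin := isLocalMin_of_deriv_deriv_pos h hf.deriv_eq_zero hc
  have hconst : f =ᶠ[𝓝 x] fun _ => f x := by
    filter_upwards [hf, hmin] with y h₁ h₂ using le_antisymm h₁ h₂
  have h0 : deriv (deriv f) x = 0 := by
    rw [hconst.deriv.deriv_eq]; simp
  exact h.ne' h0

theorem fderiv_fderiv_nonpos_of_isLocalMax {E : Type*} [NormedAddCommGroup E] [NormedSpace ℝ E]
    {f : E → ℝ} {x : E} (hf : ContDiffAt ℝ 2 f x) (hm : IsLocalMax f x) (p : E) :
    fderiv ℝ (fun y => fderiv ℝ f y p) x p ≤ 0 := by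
  let c : ℝ → E := fun s => x + s • p
  have hc (s : ℝ) : HasDerivAt c p s := by
    have := ((hasDerivAt_id s).smul_const p).const_add x
    rwa [one_smul] at this
  have hc0 : c 0 = x := by simp [c]
  have hct : Tendsto c (𝓝 0) (𝓝 x) := by
    simpa only [hc0] using (hc 0).continuousAt.tendsto
  have hd : ∀ᶠ y in 𝓝 x, DifferentiableAt ℝ f y := by
    filter_upwards [hf.eventually (by simp)] with y hy using hy.differentiableAt (by simp)
  have h1 : deriv (f ∘ c) =ᶠ[𝓝 0] fun s => fderiv ℝ f (c s) p := by
    filter_upwards [hct.eventually hd] with s hs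
    exact (hs.hasFDerivAt.comp_hasDerivAt s (hc s)).deriv
  have h2 : DifferentiableAt ℝ (fun y => fderiv ℝ f y p) x :=
    ((hf.fderiv_right (m := 1) (by norm_num)).differentiableAt (by simp)).clm_apply
      (differentiableAt_const p)
  have h3 : deriv (deriv (f ∘ c)) 0 = fderiv ℝ (fun y => fderiv ℝ f y p) x p := by
    rw [h1.deriv_eq]
    exact ((hc0 ▸ h2.hasFDerivAt :
      HasFDerivAt (fun y => fderiv ℝ f y p) (fderiv ℝ (fun y => fderiv ℝ f y p) x)
        (c 0)).comp_hasDerivAt (0 : ℝ) (hc 0)).deriv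
  rw [← h3]
  apply deriv_deriv_nonpos_of_isLocalMax
  · exact ContinuousAt.comp (hc0 ▸ hf.continuousAt) (hc 0).continuousAt
  · have := hct.eventually hm
    filter_upwards [this] with s hs
    simpa [hc0] using hs

/-- A function on the strip which is subharmonic and has vanishing normal derivative on the
boundary attains its maximum over a compact set on the relative boundary. -/
theorem le_of_subharmonic_neumann {α : ℝ × ℝ → ℝ} {K : Set (ℝ × ℝ)} {c : ℝ} (hK : IsCompact K)
    (hKS : K ⊆ strip) (hα : ContinuousOn α K)
    (hnhds : ∀ z ∈ K, c < α z → K ∈ 𝓝[strip] z)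
    (hint : ∀ z ∈ K, c < α z → z.2 ∈ Ioo (0 : ℝ) 1 → ContDiffAt ℝ 2 α z ∧
      0 ≤ fderiv ℝ (fun w => fderiv ℝ α w (1, 0)) z (1, 0) +
        fderiv ℝ (fun w => fderiv ℝ α w (0, 1)) z (0, 1))
    (hbdry : ∀ z ∈ K, c < α z → z.2 ∉ Ioo (0 : ℝ) 1 →
      HasDerivWithinAt (fun t => α (z.1, t)) 0 (Icc 0 1) z.2) :
    ∀ z ∈ K, α z ≤ c := by
  intro z₁ hz₁
  by_contra! hlt
  -- The perturbation has Laplacian `4 - 2 = 2 > 0`, and `∂h/∂t = -2 (t - 1/2)` points strictly into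
  -- the strip at both `t = 0` and `t = 1`.
  let h : ℝ × ℝ → ℝ := fun z => 2 * z.1 ^ 2 - (z.2 - 1 / 2) ^ 2
  have hh : ContDiff ℝ 2 h := by fun_prop
  obtain ⟨B, hB⟩ := hK.exists_bound_of_continuousOn hh.continuous.continuousOn
  have hB' (z) (hz : z ∈ K) : |h z| ≤ |B| + 1 :=
    (hB z hz).trans ((le_abs_self B).trans (by linarith))
  -- With this `ε` the term `ε h` varies on `K` by at most two thirds of `α z₁ - c`, so a maximum of
  -- `α + ε h` still has `α > c`. The `+ 1` keeps the denominator positive.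
  set ε := (α z₁ - c) / (3 * (|B| + 1)) with hε
  have hB0 : 0 < |B| + 1 := by positivity
  have hε0 : 0 < ε := div_pos (by linarith) (by positivity)
  have hεB : 3 * (ε * (|B| + 1)) = α z₁ - c := by rw [hε]; field_simp
  let w : ℝ × ℝ → ℝ := fun z => α z + ε * h z
  obtain ⟨z₀, hz₀, hmax⟩ := hK.exists_isMaxOn ⟨z₁, hz₁⟩
    (hα.add (continuousOn_const.mul hh.continuous.continuousOn) : ContinuousOn w K)
  have hεh (z) (hz : z ∈ K) : |ε * h z| ≤ ε * (|B| + 1) := by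
    rw [abs_mul, abs_of_pos hε0]; exact mul_le_mul_of_nonneg_left (hB' z hz) hε0.le
  have hc₀ : c < α z₀ := by
    have h1 : α z₁ + ε * h z₁ ≤ α z₀ + ε * h z₀ := hmax hz₁
    have h2 := abs_le.1 (hεh z₁ hz₁)
    have h3 := abs_le.1 (hεh z₀ hz₀)
    linarith
  have hloc : IsLocalMaxOn w strip z₀ := by
    filter_upwards [hnhds z₀ hz₀ hc₀] with z hz using hmax hz
  have hz₀S : z₀.2 ∈ Icc (0 : ℝ) 1 := (hKS hz₀).2
  by_cases hz₀i : z₀.2 ∈ Ioo (0 : ℝ) 1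
  · obtain ⟨hsm, hlap⟩ := hint z₀ hz₀ hc₀ hz₀i
    have hloc' : IsLocalMax w z₀ := hloc.isLocalMax (strip_mem_nhds hz₀i)
    have hwsm : ContDiffAt ℝ 2 w z₀ := hsm.add (contDiffAt_const.mul hh.contDiffAt)
    have hfh (z p : ℝ × ℝ) : fderiv ℝ h z p = 4 * z.1 * p.1 - 2 * (z.2 - 1 / 2) * p.2 := by
      have h1 : HasFDerivAt h _ z :=
        (((hasFDerivAt_fst (𝕜 := ℝ) (p := z)).pow 2).const_mul 2).sub
          (((hasFDerivAt_snd (𝕜 := ℝ) (p := z)).sub_const (1 / 2)).pow 2)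
      rw [h1.fderiv]; simp; ring
    have hsum (p : ℝ × ℝ) : fderiv ℝ (fun z => fderiv ℝ w z p) z₀ p =
        fderiv ℝ (fun z => fderiv ℝ α z p) z₀ p + ε * (4 * p.1 ^ 2 - 2 * p.2 ^ 2) := by
      have h1 : (fun z => fderiv ℝ w z p) =ᶠ[𝓝 z₀]
          fun z => fderiv ℝ α z p + ε * (4 * z.1 * p.1 - 2 * (z.2 - 1 / 2) * p.2) := by
        filter_upwards [hsm.eventually (by simp)] with z hz
        have h2 : HasFDerivAt w _ z := (hz.differentiableAt (by simp)).hasFDerivAt.add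
          (((hh.differentiable (by simp)) z).hasFDerivAt.const_mul ε)
        rw [h2.fderiv]
        simp [hfh]
      have h3 : DifferentiableAt ℝ (fun y => fderiv ℝ α y p) z₀ :=
        ((hsm.fderiv_right (m := 1) (by norm_num)).differentiableAt (by simp)).clm_apply
          (differentiableAt_const p)
      rw [h1.fderiv_eq]
      have h4 : HasFDerivAt (fun z : ℝ × ℝ => fderiv ℝ α z p +
          ε * (4 * z.1 * p.1 - 2 * (z.2 - 1 / 2) * p.2)) _ z₀ := h3.hasFDerivAt.add
        (((((hasFDerivAt_fst (𝕜 := ℝ) (p := z₀)).const_mul 4).mul_const p.1).sub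
          ((((hasFDerivAt_snd (𝕜 := ℝ) (p := z₀)).sub_const (1 / 2)).const_mul 2).mul_const
            p.2)).const_mul ε)
      rw [h4.fderiv]
      simp only [add_apply, smul_apply, sub_apply,
        ContinuousLinearMap.coe_fst', ContinuousLinearMap.coe_snd', smul_eq_mul]
      ring
    -- The two second derivative tests add up to `Δα + 2 ε ≤ 0`, against `Δα ≥ 0`.
    have e1 := fderiv_fderiv_nonpos_of_isLocalMax hwsm hloc' (1, 0)
    have e2 := fderiv_fderiv_nonpos_of_isLocalMax hwsm hloc' (0, 1)
    rw [hsum] at e1 e2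
    norm_num at e1 e2
    linarith
  · have hd : HasDerivWithinAt (fun t => w (z₀.1, t)) (0 + ε * (-(2 * (z₀.2 - 1 / 2))))
        (Icc 0 1) z₀.2 := by
      refine (hbdry z₀ hz₀ hc₀ hz₀i).add (HasDerivAt.hasDerivWithinAt ?_)
      refine HasDerivAt.const_mul ε ?_
      have := (((hasDerivAt_id z₀.2).sub_const (1 / 2 : ℝ)).pow 2).const_sub (2 * z₀.1 ^ 2)
      convert! this using 1
      simp
    have hslice : IsLocalMaxOn (fun t => w (z₀.1, t)) (Icc 0 1) z₀.2 := by
      have ht : Tendsto (fun t : ℝ => (z₀.1, t)) (𝓝[Icc 0 1] z₀.2) (𝓝[strip] z₀) := by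
        refine tendsto_nhdsWithin_iff.2 ⟨?_, ?_⟩
        · exact (Continuous.prodMk_right z₀.1).continuousAt.mono_left nhdsWithin_le_nhds
        · filter_upwards [self_mem_nhdsWithin] with t ht using ⟨mem_univ _, ht⟩
      exact ht.eventually hloc
    have hcone : ∀ y ∈ Icc (0 : ℝ) 1, y - z₀.2 ∈ posTangentConeAt (Icc 0 1) z₀.2 := fun y hy =>
      sub_mem_posTangentConeAt_of_segment_subset ((convex_Icc 0 1).segment_subset hz₀S hy)
    have h0 := hslice.hasFDerivWithinAt_nonpos hd.hasFDerivWithinAt (hcone 0 (by simp))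
    have h1 := hslice.hasFDerivWithinAt_nonpos hd.hasFDerivWithinAt (hcone 1 (by simp))
    have hz : z₀.2 = 0 ∨ z₀.2 = 1 := by
      by_contra! hne
      exact hz₀i ⟨lt_of_le_of_ne hz₀S.1 hne.1.symm, lt_of_le_of_ne hz₀S.2 hne.2⟩
    -- The derivative in `t` is `ε` at `t = 0` and `-ε` at `t = 1`, so `w` increases towards the
    -- opposite side.
    rcases hz with hz | hz <;> simp [hz] at h0 h1 <;> linarith

/-! ### The exterior derivative of a `1`-form along a map -/

/-- `dΩ(∂_p f, ∂_q f) = ∂_p (Ω(∂_q f)) - ∂_q (Ω(∂_p f))`. -/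
theorem DForm.d_apply_mfderiv {E : Type*} [NormedAddCommGroup E] [NormedSpace ℝ E]
    {H : Type*} [TopologicalSpace H] {I : ModelWithCorners ℝ E H} [I.Boundaryless]
    {X : Type*} [TopologicalSpace X] [ChartedSpace H X] [IsManifold I ∞ X]
    {F : Type*} [NormedAddCommGroup F] [NormedSpace ℝ F]
    {Ω : DForm I X 1} (hΩ : Ω.IsSmooth) {f : F → X} {z : F}
    (hf : ContMDiffAt 𝓘(ℝ, F) I ∞ f z) (p q : F) :
    Ω.d (f z) ![mfderiv 𝓘(ℝ, F) I f z p, mfderiv 𝓘(ℝ, F) I f z q] =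
      fderiv ℝ (fun w => Ω (f w) ![mfderiv 𝓘(ℝ, F) I f w q]) z p -
        fderiv ℝ (fun w => Ω (f w) ![mfderiv 𝓘(ℝ, F) I f w p]) z q := by
  have : IsManifold I 1 X := IsManifold.of_le (n := ∞) (by simp)
  -- `DForm.d` at `f z` is computed in this very chart, so no independence of the chart is needed.
  set φ := extChartAt I (f z)
  let y : F → E := fun w => φ (f w)
  have hy : ContDiffAt ℝ ∞ y z := by
    rw [← contMDiffAt_iff_contDiffAt]
    exact (contMDiffAt_extChartAt (n := ∞)).comp z hf
  have hsrc : ∀ᶠ w in 𝓝 z, f w ∈ φ.source :=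
    hf.continuousAt (extChartAt_source_mem_nhds (f z))
  have hfd : ∀ᶠ w in 𝓝 z, MDifferentiableAt 𝓘(ℝ, F) I f w := by
    have h1 : ContMDiffAt 𝓘(ℝ, F) I 1 f z := hf.of_le (by simp)
    filter_upwards [(contMDiffAt_iff_contMDiffAt_nhds (by simp)).1 h1] with w hw
      using hw.mdifferentiableAt (by simp)
  have hpull : ∀ᶠ w in 𝓝 z, ∀ r : F, Ω (f w) ![mfderiv 𝓘(ℝ, F) I f w r] =
      ((Ω.inChart (f z) (y w)).compContinuousLinearMap (fderiv ℝ y w)) ![r] := by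
    filter_upwards [hsrc.eventually_nhds, hfd] with w hw hwd r
    have hw' := hw.self_of_nhds
    have hyd : MDifferentiableAt 𝓘(ℝ, F) 𝓘(ℝ, E) y w :=
      (mdifferentiableAt_extChartAt (by simpa [φ] using hw')).comp w hwd
    have hsd : MDifferentiableAt 𝓘(ℝ, E) I φ.symm (y w) := by
      have := mdifferentiableWithinAt_extChartAt_symm (I := I) (φ.map_source hw')
      rwa [I.range_eq_univ, mdifferentiableWithinAt_univ] at this
    have heq : f =ᶠ[𝓝 w] φ.symm ∘ y := by
      filter_upwards [hw] with v hv using (φ.left_inv hv).symm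
    have hm : mfderiv 𝓘(ℝ, F) I f w =
        (mfderiv 𝓘(ℝ, E) I φ.symm (y w)).comp (fderiv ℝ y w) := by
      rw [heq.mfderiv_eq, mfderiv_comp w hsd hyd, mfderiv_eq_fderiv]
      rfl
    -- The base points `f w` and `φ.symm (y w)` are only propositionally equal, while all tangent
    -- spaces are the same type `E`.
    have hbase (x : X) (hx : x = f w) (a : E) : Ω (f w) ![a] = Ω x ![a] := by subst hx; rfl
    refine (hbase _ (φ.left_inv hw') _).trans ?_
    rw [hm]
    change _ = (Ω (φ.symm (y w))) _
    congr 1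
    ext j
    fin_cases j
    rfl
  have hω : DifferentiableAt ℝ (Ω.inChart (f z)) (y z) := by
    refine ((hΩ (f z)).contDiffAt ?_).differentiableAt (by simp)
    exact (isOpen_extChartAt_target (f z)).mem_nhds (mem_extChartAt_target (f z))
  let σ : F → F [⋀^Fin 1]→L[ℝ] ℝ := fun w =>
    (Ω.inChart (f z) (y w)).compContinuousLinearMap (fderiv ℝ y w)
  have hσ : DifferentiableAt ℝ σ z := by
    refine DifferentiableAt.continuousAlternatingMapCompContinuousLinearMap ?_ ?_
    · exact DifferentiableAt.comp z hω (hy.differentiableAt (by simp))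
    · exact (hy.fderiv_right (m := 1) (ENat.LEInfty.out : (2 : WithTop ℕ∞) ≤ ∞)).differentiableAt (by simp)
  -- The exterior derivative commutes with pull-back by `y`. On the vector space `F` the fields `p`,
  -- `q` are constant, so its formula has no bracket term.
  have hext : extDeriv σ z = (extDeriv (Ω.inChart (f z)) (y z)).compContinuousLinearMap
      (fderiv ℝ y z) :=
    extDeriv_pullback hω (hy.of_le ENat.LEInfty.out : ContDiffAt ℝ 2 y z) (by simp)
  have hfy : fderiv ℝ y z = (mfderiv I 𝓘(ℝ, E) φ (f z)).comp (mfderiv 𝓘(ℝ, F) I f z) := by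
    rw [← mfderiv_eq_fderiv]
    exact mfderiv_comp z (mdifferentiableAt_extChartAt (mem_chart_source H (f z)))
      hfd.self_of_nhds
  have hr (r : F) : (fun w => Ω (f w) ![mfderiv 𝓘(ℝ, F) I f w r]) =ᶠ[𝓝 z] fun w => σ w ![r] := by
    filter_upwards [hpull] with w hw using hw r
  rw [(hr p).fderiv_eq, (hr q).fderiv_eq]
  have h1 : extDeriv σ z ![p, q] =
      fderiv ℝ (fun w => σ w ![q]) z p - fderiv ℝ (fun w => σ w ![p]) z q := by
    have e0 : Fin.removeNth 0 ![p, q] = ![q] := by ext j; fin_cases j; rfl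
    have e1 : Fin.removeNth 1 ![p, q] = ![p] := by ext j; fin_cases j; rfl
    rw [extDeriv_apply hσ, Fin.sum_univ_two, e0, e1]
    simp [sub_eq_add_neg]
  rw [← h1, hext, hfy]
  refine congrArg (extDeriv (Ω.inChart (f z)) (φ (f z))) ?_
  ext j
  fin_cases j <;> rfl

/-! ### The strip as a closed domain with unique derivatives -/

theorem isClosed_strip : IsClosed strip := isClosed_univ.prod isClosed_Icc

theorem uniqueMDiffWithinAt_strip {z : ℝ × ℝ} (hz : z ∈ strip) :
    UniqueMDiffWithinAt 𝓘(ℝ, ℝ × ℝ) strip z := by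
  rw [uniqueMDiffWithinAt_iff_uniqueDiffWithinAt]
  exact (uniqueDiffOn_univ.prod (uniqueDiffOn_Icc zero_lt_one)) z hz

/-! ### Compatible complex structures on the symplectization -/

namespace ContactManifold

variable {n : ℕ} (M : ContactManifold.{u} n)

/-- If `D` is an injective linear map which intertwines `Ī` and `J`, then the equation
`D (a₁, w₁) + J (D (a₂, w₂)) = 0` splits into its components. -/
theorem components_of_equation {x : M} {W : Type*} [AddCommGroup W] [Module ℝ W]
    {I : ∀ x : M, M.xi x →ₗ[ℝ] M.xi x} (hI : M.IsCompatibleOnXi I)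
    {D : ℝ × TangentSpace (𝓡 (2 * n + 1)) x →ₗ[ℝ] W} (hD : Function.Injective D) {J : W → W}
    (hJ : ∀ (a b : ℝ) (k : M.xi x), J (D (a, b • M.reeb x + k)) = D (-b, a • M.reeb x + I x k))
    {a₁ a₂ : ℝ} {w₁ w₂ : TangentSpace (𝓡 (2 * n + 1)) x} (h : D (a₁, w₁) + J (D (a₂, w₂)) = 0) :
    a₁ = M.form x ![w₂] ∧ a₂ = -M.form x ![w₁] ∧ 0 ≤ M.form.d x ![w₁, w₂] := by
  let T := TangentSpace (𝓡 (2 * n + 1)) x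
  have l_smul : ∀ (c : ℝ) (v : T), M.form x ![c • v] = c * M.form x ![v] := fun c v =>
    (M.form x).toAlternatingMap.map_vecCons_smul ![] c v
  have l_add : ∀ v w : T, M.form x ![v + w] = M.form x ![v] + M.form x ![w] := fun v w =>
    (M.form x).toAlternatingMap.map_vecCons_add ![] v w
  have anti : ∀ v w : T, M.form.d x ![w, v] = -M.form.d x ![v, w] := fun v w => by
    have hs := (M.form.d x).toAlternatingMap.map_swap ![v, w] (i := 0) (j := 1) (by decide)
    have : (![v, w] : Fin 2 → T) ∘ Equiv.swap (0 : Fin 2) 1 = ![w, v] := by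
      ext j; fin_cases j <;> simp
    rwa [this] at hs
  have b_smul : ∀ (c : ℝ) (v w : T), M.form.d x ![c • v, w] = c * M.form.d x ![v, w] :=
    fun c v w => (M.form.d x).toAlternatingMap.map_vecCons_smul ![w] c v
  have b_add : ∀ v v' w : T, M.form.d x ![v + v', w] = M.form.d x ![v, w] + M.form.d x ![v', w] :=
    fun v v' w => (M.form.d x).toAlternatingMap.map_vecCons_add ![w] v v'
  obtain ⟨hX₁, hX₂⟩ := M.isReebVector_reeb x
  set b := M.form x ![w₂] with hb
  have hk : w₂ + (-b) • M.reeb x ∈ M.xi x := by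
    change M.form x ![w₂ + (-b) • M.reeb x] = 0
    have e1 := l_add w₂ ((-b) • M.reeb x)
    rw [l_smul, hX₁] at e1
    rw [e1, ← hb]; ring
  -- The `ξ`-component of `w₂`. Injectivity of `D` then forces `a₁ = b` and `w₁ = -a₂ X_λ - I k`.
  let k : M.xi x := ⟨w₂ + (-b) • M.reeb x, hk⟩
  have hw₂ : w₂ = b • M.reeb x + k := by simp only [k]; module
  have hJ' := hJ a₂ b k
  rw [← hw₂] at hJ'
  rw [hJ', ← map_add] at h
  have h0 := (map_eq_zero_iff D hD).1 h
  have h1 : a₁ + -b = 0 := congrArg Prod.fst h0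
  have h2 : w₁ + (a₂ • M.reeb x + I x k) = 0 := congrArg Prod.snd h0
  have hw₁ : w₁ = (-a₂) • M.reeb x + (-1 : ℝ) • (I x k : T) := by
    rw [eq_neg_of_add_eq_zero_left h2]; module
  refine ⟨by linarith, ?_, ?_⟩
  · have e1 := l_add ((-a₂) • M.reeb x) ((-1 : ℝ) • (I x k : T))
    have e2 : M.form x ![(I x k : T)] = 0 := (I x k).2
    rw [l_smul, l_smul, hX₁, e2] at e1
    rw [hw₁, e1]; ring
  -- The Reeb terms are in the kernel of `dλ`, which leaves `dλ(-I k, k) = dλ(k, I k) ≥ 0`.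
  · have e1 := b_add ((-a₂) • M.reeb x) ((-1 : ℝ) • (I x k : T)) (b • M.reeb x + k)
    have e2 := b_add (b • M.reeb x) (k : T) (I x k : T)
    rw [b_smul, b_smul, hX₂, anti (b • M.reeb x + k) (I x k), e2, b_smul, hX₂] at e1
    have e3 : 0 ≤ M.form.d x ![(k : T), (I x k : T)] := by
      by_cases hk0 : k = 0
      · have := b_smul 0 (k : T) (I x k : T)
        rw [hk0] at this ⊢
        simp only [zero_smul, zero_mul] at this
        exact this.ge
      · exact (hI.pos x k hk0).le
    rw [hw₁, hw₂, e1]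
    linarith

end ContactManifold

/-! ### Cylindrical ends -/

namespace CylindricalEnd

variable {n : ℕ} {X : Type*} [TopologicalSpace X]
  [ChartedSpace (EuclideanSpace ℝ (Fin (2 * (n + 1)))) X]
  {Ω : DForm (𝓡 (2 * (n + 1))) X 2} {M : ContactManifold.{u} n} {S : Set ℝ} {l : Filter ℝ}

/-- Closedness is local, and by properness of the end a compact neighbourhood meets the image only
in bounded heights `[c, c']`. That piece is compact since `M` is, and `c > R` keeps it inside the
domain of the chart. -/
theorem isClosed_image_Ici_prod_univ [T2Space X] {R c : ℝ} (e : ConvexEnd Ω M R) (hc : R < c) :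
    IsClosed (e.chart '' (Ici c ×ˢ univ)) := by
  have : LocallyCompactSpace X :=
    ChartedSpace.locallyCompactSpace (EuclideanSpace ℝ (Fin (2 * (n + 1)))) X
  refine isClosed_of_closure_subset fun x hx => ?_
  obtain ⟨K, hK, hxK⟩ := exists_compact_mem_nhds x
  obtain ⟨P, hP, Q, hQ, hPQ⟩ := mem_prod_iff.1 (e.proper hK.compl_mem_cocompact)
  obtain ⟨c', hc'⟩ := mem_atTop_sets.1 hP
  obtain rfl : Q = univ := by simpa using hQ
  have hsub : e.chart '' (Ici c ×ˢ univ) ∩ K ⊆ e.chart '' (Icc c c' ×ˢ univ) := by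
    rintro _ ⟨⟨p, hp, rfl⟩, hpK⟩
    refine ⟨p, ⟨⟨hp.1, ?_⟩, mem_univ _⟩, rfl⟩
    by_contra! hlt
    exact hPQ ⟨hc' _ hlt.le, mem_univ _⟩ hpK
  have hcl : IsClosed (e.chart '' (Icc c c' ×ˢ univ)) := by
    refine ((isCompact_Icc.prod isCompact_univ).image_of_continuousOn
      (e.chart.continuousOn.mono ?_)).isClosed
    rw [e.source_eq]
    exact prod_mono (fun a ha => hc.trans_le ha.1) (subset_univ _)
  have hx' : x ∈ closure (e.chart '' (Ici c ×ˢ univ) ∩ K) := by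
    rw [mem_closure_iff_frequently] at hx ⊢
    exact hx.and_eventually hxK
  obtain ⟨p, hp, rfl⟩ := hcl.closure_subset_iff.2 hsub hx'
  exact ⟨p, ⟨hp.1.1, hp.2⟩, rfl⟩

variable (e : CylindricalEnd Ω M S l)

theorem mdifferentiable_chart :
    e.chart.MDifferentiable (𝓘(ℝ, ℝ).prod (𝓡 (2 * n + 1))) (𝓡 (2 * (n + 1))) :=
  ⟨e.smooth.mdifferentiableOn (by simp), e.smooth_symm.mdifferentiableOn (by simp)⟩

theorem contMDiffAt_symm {x : X} (hx : x ∈ e.chart.target) :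
    ContMDiffAt (𝓡 (2 * (n + 1))) (𝓘(ℝ, ℝ).prod (𝓡 (2 * n + 1))) ∞ e.chart.symm x :=
  e.smooth_symm.contMDiffAt (e.chart.open_target.mem_nhds hx)

/-- A smooth curve in a Lagrangian cylinder projects to a curve in its base. -/
theorem isTangentTo_of_curve {L : Set X} {Λ : Set M} (hL : e.IsCylinderOver L Λ) {x : X}
    (hx : x ∈ e.chart.target) {v : TangentSpace (𝓡 (2 * (n + 1))) x}
    (hv : IsTangentTo (2 * (n + 1)) L x v) :
    IsTangentTo (2 * n + 1) Λ (e.chart.symm x).2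
      (mfderiv (𝓡 (2 * (n + 1))) (𝓘(ℝ, ℝ).prod (𝓡 (2 * n + 1))) e.chart.symm x v).2 := by
  obtain ⟨c, hc0, hcL, hcs, hcd⟩ := hv
  subst hc0
  refine ⟨fun s => (e.chart.symm (c s)).2, rfl, ?_, ?_, ?_⟩
  · filter_upwards [hcL, hcs.continuousAt (e.chart.open_target.mem_nhds hx)] with s hs hst
    rw [← e.chart.right_inv hst] at hs
    exact (hL _ (e.chart.map_target hst)).1 hs
  · exact contMDiffAt_snd.comp 0 ((e.contMDiffAt_symm hx).comp 0 hcs)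
  · have h1 := ((e.contMDiffAt_symm hx).mdifferentiableAt (by simp)).hasMFDerivAt.comp (0 : ℝ) hcd
    have h2 := (hasMFDerivAt_snd (I := 𝓘(ℝ, ℝ)) (I' := 𝓡 (2 * n + 1))
      (e.chart.symm (c 0))).comp (0 : ℝ) h1
    refine h2.congr_mfderiv ?_
    ext1
    set A := mfderiv (𝓡 (2 * (n + 1))) (𝓘(ℝ, ℝ).prod (𝓡 (2 * n + 1))) e.chart.symm (c 0)
    change (A ((1 : ℝ) • v)).2 = (1 : ℝ) • (A v).2
    rw [one_smul, one_smul]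

/-- Vectors tangent to a cylinder over a Legendrian lie in `ℝ ∂_α ⊕ ξ`. At a common point of the two
cylinders their sums stay there and miss the Reeb direction, against transversality. -/
theorem disjoint_of_transversal {L₀ L₁ : Set X} {Λ₀ Λ₁ : Set M}
    (h : Transversal (2 * (n + 1)) L₀ L₁) (hL₀ : e.IsCylinderOver L₀ Λ₀)
    (hL₁ : e.IsCylinderOver L₁ Λ₁) (hΛ₀ : M.IsLegendrian Λ₀) (hΛ₁ : M.IsLegendrian Λ₁) :
    Disjoint (L₀ ∩ L₁) e.chart.target := by
  refine disjoint_left.2 fun x hxL hx => ?_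
  obtain ⟨p, hp, rfl⟩ : ∃ p ∈ e.chart.source, e.chart p = x :=
    ⟨_, e.chart.map_target hx, e.chart.right_inv hx⟩
  let D := e.mdifferentiable_chart.mfderiv hp
  obtain ⟨v₀, v₁, hv₀, hv₁, hv⟩ := h _ hxL (D ((0 : ℝ), M.reeb p.2))
  have key (L : Set X) (Λ : Set M) (hL : e.IsCylinderOver L Λ) (hΛ : M.IsLegendrian Λ)
      (hpL : e.chart p ∈ L) (v) (hvL : IsTangentTo (2 * (n + 1)) L (e.chart p) v) :
      M.form p.2 ![(D.symm v).2] = 0 := by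
    have h1 := e.isTangentTo_of_curve hL hx hvL
    have h2 := fun h => hΛ.tangent_le (e.chart.symm (e.chart p)).2 h _ h1
    have h3 (q : ℝ × M) (hq : q = e.chart.symm (e.chart p)) (w : EuclideanSpace ℝ (Fin (2 * n + 1)))
        (hw : M.form (e.chart.symm (e.chart p)).2 ![w] = 0) : M.form q.2 ![w] = 0 := by
      subst hq; exact hw
    refine h3 p (e.chart.left_inv hp).symm _ (h2 ?_)
    rw [e.chart.left_inv hp]
    exact (hL p hp).1 hpL
  have k₀ := key L₀ Λ₀ hL₀ hΛ₀ hxL.1 v₀ hv₀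
  have k₁ := key L₁ Λ₁ hL₁ hΛ₁ hxL.2 v₁ hv₁
  have hsum : M.reeb p.2 = (D.symm v₀).2 + (D.symm v₁).2 := by
    have h1 := ((D.symm_apply_apply _).symm.trans (congrArg D.symm hv)).trans (map_add _ _ _)
    exact congrArg Prod.snd h1
  have h1 := (M.xi p.2).add_mem (x := (D.symm v₀).2) (y := (D.symm v₁).2) k₀ k₁
  have h2 (w) (hw : M.reeb p.2 = w) (hw' : w ∈ M.xi p.2) : False := by
    subst hw
    exact one_ne_zero ((M.isReebVector_reeb p.2).1.symm.trans hw')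
  exact h2 _ hsum h1

end CylindricalEnd

/-! ### Strips in a cylindrical end -/

namespace CylindricalEnd

variable {n : ℕ} {X : Type*} [TopologicalSpace X]
  [ChartedSpace (EuclideanSpace ℝ (Fin (2 * (n + 1)))) X]
  {Ω : DForm (𝓡 (2 * (n + 1))) X 2} {M : ContactManifold.{u} n} {S : Set ℝ} {l : Filter ℝ}
  (e : CylindricalEnd Ω M S l) (v : ℝ × ℝ → X)

/-- The `ℝ`-coordinate of a map into the end. -/
def height (z : ℝ × ℝ) : ℝ := (e.chart.symm (v z)).1

/-- The `M`-coordinate of a map into the end. -/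
def proj (z : ℝ × ℝ) : M := (e.chart.symm (v z)).2

variable {v}

theorem contMDiffWithinAt_height (hv : ContMDiffOn 𝓘(ℝ, ℝ × ℝ) (𝓡 (2 * (n + 1))) ∞ v strip)
    {z : ℝ × ℝ} (hz : z ∈ strip) (hvz : v z ∈ e.chart.target) :
    ContMDiffWithinAt 𝓘(ℝ, ℝ × ℝ) 𝓘(ℝ, ℝ) ∞ (e.height v) strip z :=
  (contMDiffAt_fst (I := 𝓘(ℝ, ℝ)) (J := 𝓡 (2 * n + 1))).comp_contMDiffWithinAt z
    ((e.contMDiffAt_symm hvz).comp_contMDiffWithinAt z (hv z hz))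

theorem contMDiffWithinAt_proj (hv : ContMDiffOn 𝓘(ℝ, ℝ × ℝ) (𝓡 (2 * (n + 1))) ∞ v strip)
    {z : ℝ × ℝ} (hz : z ∈ strip) (hvz : v z ∈ e.chart.target) :
    ContMDiffWithinAt 𝓘(ℝ, ℝ × ℝ) (𝓡 (2 * n + 1)) ∞ (e.proj v) strip z :=
  (contMDiffAt_snd (I := 𝓘(ℝ, ℝ)) (J := 𝓡 (2 * n + 1))).comp_contMDiffWithinAt z
    ((e.contMDiffAt_symm hvz).comp_contMDiffWithinAt z (hv z hz))

theorem mfderivWithin_height_apply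
    (hv : ContMDiffOn 𝓘(ℝ, ℝ × ℝ) (𝓡 (2 * (n + 1))) ∞ v strip)
    {z : ℝ × ℝ} (hz : z ∈ strip) (hvz : v z ∈ e.chart.target) (p : ℝ × ℝ) :
    mfderivWithin 𝓘(ℝ, ℝ × ℝ) 𝓘(ℝ, ℝ) (e.height v) strip z p =
      (mfderiv (𝓡 (2 * (n + 1))) (𝓘(ℝ, ℝ).prod (𝓡 (2 * n + 1))) e.chart.symm (v z)
        (mfderivWithin 𝓘(ℝ, ℝ × ℝ) (𝓡 (2 * (n + 1))) v strip z p)).1 := by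
  have h1 := ((hv z hz).mdifferentiableWithinAt (by simp)).hasMFDerivWithinAt
  have h2 := ((e.contMDiffAt_symm hvz).mdifferentiableAt (by simp)).hasMFDerivAt
  have h3 := (hasMFDerivAt_fst (I := 𝓘(ℝ, ℝ)) (I' := 𝓡 (2 * n + 1))
    (e.chart.symm (v z))).comp_hasMFDerivWithinAt z (h2.comp_hasMFDerivWithinAt z h1)
  have h4 := HasMFDerivWithinAt.mfderivWithin h3 (uniqueMDiffWithinAt_strip hz)
  exact congrArg (fun A : ℝ × ℝ →L[ℝ] ℝ => A p) h4

theorem mfderivWithin_proj_apply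
    (hv : ContMDiffOn 𝓘(ℝ, ℝ × ℝ) (𝓡 (2 * (n + 1))) ∞ v strip)
    {z : ℝ × ℝ} (hz : z ∈ strip) (hvz : v z ∈ e.chart.target) (p : ℝ × ℝ) :
    mfderivWithin 𝓘(ℝ, ℝ × ℝ) (𝓡 (2 * n + 1)) (e.proj v) strip z p =
      (mfderiv (𝓡 (2 * (n + 1))) (𝓘(ℝ, ℝ).prod (𝓡 (2 * n + 1))) e.chart.symm (v z)
        (mfderivWithin 𝓘(ℝ, ℝ × ℝ) (𝓡 (2 * (n + 1))) v strip z p)).2 := by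
  have h1 := ((hv z hz).mdifferentiableWithinAt (by simp)).hasMFDerivWithinAt
  have h2 := ((e.contMDiffAt_symm hvz).mdifferentiableAt (by simp)).hasMFDerivAt
  have h3 := (hasMFDerivAt_snd (I := 𝓘(ℝ, ℝ)) (I' := 𝓡 (2 * n + 1))
    (e.chart.symm (v z))).comp_hasMFDerivWithinAt z (h2.comp_hasMFDerivWithinAt z h1)
  have h4 := HasMFDerivWithinAt.mfderivWithin h3 (uniqueMDiffWithinAt_strip hz)
  exact congrArg (fun A : ℝ × ℝ →L[ℝ] EuclideanSpace ℝ (Fin (2 * n + 1)) => A p) h4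

/-- In the coordinates of the end, the equation `∂v/∂τ + J_t(v) ∂v/∂t = 0` for `v = (α, m)` says
`∂α/∂τ = λ(∂m/∂t)`, `∂α/∂t = -λ(∂m/∂τ)` and implies `dλ(∂m/∂τ, ∂m/∂t) ≥ 0`. -/
theorem equation_components {J : TimeDependentEndo n X} (hJ : e.IsCylindricalFamily J)
    (hv : ContMDiffOn 𝓘(ℝ, ℝ × ℝ) (𝓡 (2 * (n + 1))) ∞ v strip)
    (heq : ∀ z ∈ strip,
      mfderivWithin 𝓘(ℝ, ℝ × ℝ) (𝓡 (2 * (n + 1))) v strip z ((1, 0) : ℝ × ℝ) +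
      J z.2 (v z) (mfderivWithin 𝓘(ℝ, ℝ × ℝ) (𝓡 (2 * (n + 1))) v strip z ((0, 1) : ℝ × ℝ)) = 0)
    {z : ℝ × ℝ} (hz : z ∈ strip) (hvz : v z ∈ e.chart.target) :
    mfderivWithin 𝓘(ℝ, ℝ × ℝ) 𝓘(ℝ, ℝ) (e.height v) strip z ((1, 0) : ℝ × ℝ) =
      M.form (e.proj v z)
        ![mfderivWithin 𝓘(ℝ, ℝ × ℝ) (𝓡 (2 * n + 1)) (e.proj v) strip z ((0, 1) : ℝ × ℝ)] ∧
    mfderivWithin 𝓘(ℝ, ℝ × ℝ) 𝓘(ℝ, ℝ) (e.height v) strip z ((0, 1) : ℝ × ℝ) =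
      -M.form (e.proj v z)
        ![mfderivWithin 𝓘(ℝ, ℝ × ℝ) (𝓡 (2 * n + 1)) (e.proj v) strip z ((1, 0) : ℝ × ℝ)] ∧
    0 ≤ M.form.d (e.proj v z)
        ![mfderivWithin 𝓘(ℝ, ℝ × ℝ) (𝓡 (2 * n + 1)) (e.proj v) strip z ((1, 0) : ℝ × ℝ),
          mfderivWithin 𝓘(ℝ, ℝ × ℝ) (𝓡 (2 * n + 1)) (e.proj v) strip z ((0, 1) : ℝ × ℝ)] := by
  obtain ⟨I, hI, hIJ⟩ := hJ
  set p := e.chart.symm (v z) with hp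
  have hps : p ∈ e.chart.source := e.chart.map_target hvz
  let D : ℝ × EuclideanSpace ℝ (Fin (2 * n + 1)) →L[ℝ] EuclideanSpace ℝ (Fin (2 * (n + 1))) :=
    mfderiv (𝓘(ℝ, ℝ).prod (𝓡 (2 * n + 1))) (𝓡 (2 * (n + 1))) e.chart p
  let D' : EuclideanSpace ℝ (Fin (2 * (n + 1))) →L[ℝ] ℝ × EuclideanSpace ℝ (Fin (2 * n + 1)) :=
    mfderiv (𝓡 (2 * (n + 1))) (𝓘(ℝ, ℝ).prod (𝓡 (2 * n + 1))) e.chart.symm (v z)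
  let V : ℝ × ℝ →L[ℝ] EuclideanSpace ℝ (Fin (2 * (n + 1))) :=
    mfderivWithin 𝓘(ℝ, ℝ × ℝ) (𝓡 (2 * (n + 1))) v strip z
  let J' : EuclideanSpace ℝ (Fin (2 * (n + 1))) →L[ℝ] EuclideanSpace ℝ (Fin (2 * (n + 1))) :=
    J z.2 (v z)
  have hDD' (w) : D (D' w) = w := by
    have := e.mdifferentiable_chart.comp_symm_deriv hvz
    exact congrArg (fun A : EuclideanSpace ℝ (Fin (2 * (n + 1))) →L[ℝ]
      EuclideanSpace ℝ (Fin (2 * (n + 1))) => A w) this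
  have hDinj : Function.Injective D := e.mdifferentiable_chart.mfderiv_injective hps
  -- Moves `J` from `v z` to the equal point `e.chart p`, where the cylindrical form of `J` is
  -- given.
  have hbase (x : X) (hx : v z = x) (w : EuclideanSpace ℝ (Fin (2 * (n + 1)))) :
      J' w = J z.2 x w := by subst hx; rfl
  have hJD (a b : ℝ) (k : M.xi p.2) :
      J' (D (a, b • M.reeb p.2 + (k : TangentSpace (𝓡 (2 * n + 1)) p.2))) =
        D (-b, a • M.reeb p.2 + (I z.2 p.2 k : TangentSpace (𝓡 (2 * n + 1)) p.2)) :=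
    (hbase _ (e.chart.right_inv hvz).symm _).trans (hIJ z.2 hz.2 p hps a b k)
  have heq' : D (D' (V (1, 0))) + J' (D (D' (V (0, 1)))) = 0 := by
    rw [hDD', hDD']; exact heq z hz
  have key := M.components_of_equation (x := p.2) (hI z.2 hz.2) (D := D.toLinearMap)
    (J := J') hDinj hJD (a₁ := (D' (V (1, 0))).1) (w₁ := (D' (V (1, 0))).2)
    (a₂ := (D' (V (0, 1))).1) (w₂ := (D' (V (0, 1))).2) heq'
  rw [e.mfderivWithin_height_apply hv hz hvz, e.mfderivWithin_height_apply hv hz hvz,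
    e.mfderivWithin_proj_apply hv hz hvz, e.mfderivWithin_proj_apply hv hz hvz]
  exact key

/-- A curve in a Legendrian cylinder has a velocity on which `λ` vanishes. -/
theorem form_mfderivWithin_proj_eq_zero {L : Set X} {Λ : Set M} (hL : e.IsCylinderOver L Λ)
    (hΛ : M.IsLegendrian Λ) (hv : ContMDiffOn 𝓘(ℝ, ℝ × ℝ) (𝓡 (2 * (n + 1))) ∞ v strip)
    {z : ℝ × ℝ} (hz : z ∈ strip) (hvz : v z ∈ e.chart.target) (hvL : ∀ τ, v (τ, z.2) ∈ L) :
    M.form (e.proj v z)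
      ![mfderivWithin 𝓘(ℝ, ℝ × ℝ) (𝓡 (2 * n + 1)) (e.proj v) strip z ((1, 0) : ℝ × ℝ)] = 0 := by
  rw [e.mfderivWithin_proj_apply hv hz hvz]
  -- Moving in `τ` alone stays on the boundary line, so `v ∘ c` is a curve in `L` with velocity
  -- `∂v/∂τ`.
  let c : ℝ → ℝ × ℝ := fun s => (z.1 + s, z.2)
  have hc0 : c 0 = z := by simp [c]
  have hcS (s) : c s ∈ strip := ⟨mem_univ _, hz.2⟩
  have hcd : HasFDerivAt c (ContinuousLinearMap.toSpanSingleton ℝ ((1, 0) : ℝ × ℝ)) 0 := by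
    have h1 := ((hasDerivAt_id (0 : ℝ)).const_add z.1).prodMk (hasDerivAt_const (0 : ℝ) z.2)
    exact h1.hasFDerivAt
  have hcs : ContMDiff 𝓘(ℝ, ℝ) 𝓘(ℝ, ℝ × ℝ) ∞ c := by
    rw [contMDiff_iff_contDiff]; fun_prop
  have htan : IsTangentTo (2 * (n + 1)) L (v z)
      (mfderivWithin 𝓘(ℝ, ℝ × ℝ) (𝓡 (2 * (n + 1))) v strip z ((1, 0) : ℝ × ℝ)) := by
    refine ⟨v ∘ c, by simp [hc0], Eventually.of_forall fun s => hvL _, ?_, ?_⟩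
    · rw [← contMDiffWithinAt_univ]
      exact (hv (c 0) (hcS 0)).comp 0 hcs.contMDiffAt.contMDiffWithinAt fun s _ => hcS s
    · let V : ℝ × ℝ →L[ℝ] EuclideanSpace ℝ (Fin (2 * (n + 1))) :=
        mfderivWithin 𝓘(ℝ, ℝ × ℝ) (𝓡 (2 * (n + 1))) v strip z
      have h1 (w) (hw : w = z) :
          HasMFDerivWithinAt 𝓘(ℝ, ℝ × ℝ) (𝓡 (2 * (n + 1))) v strip w V := by
        subst hw
        exact ((hv w hz).mdifferentiableWithinAt (by simp)).hasMFDerivWithinAt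
      have h2 := (h1 (c 0) hc0).comp (0 : ℝ) hcd.hasMFDerivAt.hasMFDerivWithinAt (s := univ) fun s _ => hcS s
      rw [hasMFDerivWithinAt_univ] at h2
      refine h2.congr_mfderiv ?_
      ext1
      change V ((1 : ℝ) • (1, 0)) = (1 : ℝ) • V (1, 0)
      rw [one_smul, one_smul]
  have h1 := e.isTangentTo_of_curve hL hvz htan
  refine hΛ.tangent_le _ ?_ _ h1
  have h2 : v z ∈ L := hvL z.1
  rw [← e.chart.right_inv hvz] at h2
  exact (hL _ (e.chart.map_target hvz)).1 h2

end CylindricalEnd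

/-! ### Subharmonicity and the Neumann condition for the height -/

namespace CylindricalEnd

variable {n : ℕ} {X : Type*} [TopologicalSpace X]
  [ChartedSpace (EuclideanSpace ℝ (Fin (2 * (n + 1)))) X]
  {Ω : DForm (𝓡 (2 * (n + 1))) X 2} {M : ContactManifold.{u} n} {S : Set ℝ} {l : Filter ℝ}
  (e : CylindricalEnd Ω M S l) {v : ℝ × ℝ → X}

/-- At the interior points of the strip, the `ℝ`-coordinate of a pseudo-holomorphic map into a
cylindrical end is subharmonic. -/
theorem laplacian_height_nonneg {J : TimeDependentEndo n X} (hJ : e.IsCylindricalFamily J)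
    (hv : ContMDiffOn 𝓘(ℝ, ℝ × ℝ) (𝓡 (2 * (n + 1))) ∞ v strip)
    (heq : ∀ z ∈ strip,
      mfderivWithin 𝓘(ℝ, ℝ × ℝ) (𝓡 (2 * (n + 1))) v strip z ((1, 0) : ℝ × ℝ) +
      J z.2 (v z) (mfderivWithin 𝓘(ℝ, ℝ × ℝ) (𝓡 (2 * (n + 1))) v strip z ((0, 1) : ℝ × ℝ)) = 0)
    {z : ℝ × ℝ} (hz : z.2 ∈ Ioo (0 : ℝ) 1) (hvz : v z ∈ e.chart.target) :
    0 ≤ fderiv ℝ (fun w => fderiv ℝ (e.height v) w (1, 0)) z (1, 0) +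
      fderiv ℝ (fun w => fderiv ℝ (e.height v) w (0, 1)) z (0, 1) := by
  have hS : strip ∈ 𝓝 z := strip_mem_nhds hz
  have hcont : ContinuousAt v z :=
    ((hv z (mem_of_mem_nhds hS)).continuousWithinAt).continuousAt hS
  have hev : ∀ᶠ w in 𝓝 z, strip ∈ 𝓝 w ∧ v w ∈ e.chart.target :=
    (eventually_mem_nhds_iff.2 hS).and (hcont (e.chart.open_target.mem_nhds hvz))
  -- The first-order relations hold on a whole neighbourhood of `z`, so they may be differentiated
  -- at `z`.
  have hcomp : ∀ᶠ w in 𝓝 z,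
      fderiv ℝ (e.height v) w (1, 0) = M.form (e.proj v w)
        ![mfderiv 𝓘(ℝ, ℝ × ℝ) (𝓡 (2 * n + 1)) (e.proj v) w ((0, 1) : ℝ × ℝ)] ∧
      fderiv ℝ (e.height v) w (0, 1) = -M.form (e.proj v w)
        ![mfderiv 𝓘(ℝ, ℝ × ℝ) (𝓡 (2 * n + 1)) (e.proj v) w ((1, 0) : ℝ × ℝ)] ∧
      0 ≤ M.form.d (e.proj v w)
        ![mfderiv 𝓘(ℝ, ℝ × ℝ) (𝓡 (2 * n + 1)) (e.proj v) w ((1, 0) : ℝ × ℝ),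
          mfderiv 𝓘(ℝ, ℝ × ℝ) (𝓡 (2 * n + 1)) (e.proj v) w ((0, 1) : ℝ × ℝ)] := by
    filter_upwards [hev] with w hw
    have := e.equation_components hJ hv heq (mem_of_mem_nhds hw.1) hw.2
    rwa [mfderivWithin_of_mem_nhds hw.1, mfderivWithin_of_mem_nhds hw.1, mfderiv_eq_fderiv]
      at this
  have h1 : (fun w => fderiv ℝ (e.height v) w (1, 0)) =ᶠ[𝓝 z] fun w => M.form (e.proj v w)
      ![mfderiv 𝓘(ℝ, ℝ × ℝ) (𝓡 (2 * n + 1)) (e.proj v) w ((0, 1) : ℝ × ℝ)] :=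
    hcomp.mono fun w hw => hw.1
  have h2 : (fun w => fderiv ℝ (e.height v) w (0, 1)) =ᶠ[𝓝 z] fun w => -M.form (e.proj v w)
      ![mfderiv 𝓘(ℝ, ℝ × ℝ) (𝓡 (2 * n + 1)) (e.proj v) w ((1, 0) : ℝ × ℝ)] :=
    hcomp.mono fun w hw => hw.2.1
  have h3 := DForm.d_apply_mfderiv M.smooth
    ((e.contMDiffWithinAt_proj hv (mem_of_mem_nhds hS) hvz).contMDiffAt hS) (1, 0) (0, 1)
  rw [h1.fderiv_eq, h2.fderiv_eq, fderiv_fun_neg, neg_apply, ← sub_eq_add_neg, ← h3]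
  exact hcomp.self_of_nhds.2.2

/-- At the boundary points of the strip at which the boundary condition is a Legendrian cylinder,
the `ℝ`-coordinate of a pseudo-holomorphic map into a cylindrical end has vanishing normal
derivative. -/
theorem hasDerivWithinAt_height_zero {J : TimeDependentEndo n X} (hJ : e.IsCylindricalFamily J)
    (hv : ContMDiffOn 𝓘(ℝ, ℝ × ℝ) (𝓡 (2 * (n + 1))) ∞ v strip)
    (heq : ∀ z ∈ strip,
      mfderivWithin 𝓘(ℝ, ℝ × ℝ) (𝓡 (2 * (n + 1))) v strip z ((1, 0) : ℝ × ℝ) +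
      J z.2 (v z) (mfderivWithin 𝓘(ℝ, ℝ × ℝ) (𝓡 (2 * (n + 1))) v strip z ((0, 1) : ℝ × ℝ)) = 0)
    {L : Set X} {Λ : Set M} (hL : e.IsCylinderOver L Λ) (hΛ : M.IsLegendrian Λ)
    {z : ℝ × ℝ} (hz : z ∈ strip) (hvz : v z ∈ e.chart.target) (hvL : ∀ τ, v (τ, z.2) ∈ L) :
    HasDerivWithinAt (fun t => e.height v (z.1, t)) 0 (Icc 0 1) z.2 := by
  have h1 := (e.equation_components hJ hv heq hz hvz).2.1
  rw [e.form_mfderivWithin_proj_eq_zero hL hΛ hv hz hvz hvL, neg_zero,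
    mfderivWithin_eq_fderivWithin] at h1
  have h2 : HasFDerivWithinAt (e.height v) _ strip z :=
    ((e.contMDiffWithinAt_height hv hz hvz).contDiffWithinAt.differentiableWithinAt
      (by simp)).hasFDerivWithinAt
  have h3 := h2.comp_hasDerivWithinAt z.2 (f := fun t => (z.1, t)) (s := Icc 0 1)
    (((hasDerivAt_const z.2 z.1).prodMk (hasDerivAt_id z.2)).hasDerivWithinAt)
    fun t ht => ⟨mem_univ _, ht⟩
  exact h3.congr_deriv h1

end CylindricalEnd

/-! ### Compactness of the part of a strip in a convex end -/

section Asymptotics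

variable {n : ℕ} {X : Type*} [TopologicalSpace X]
  [ChartedSpace (EuclideanSpace ℝ (Fin (2 * (n + 1)))) X] {Ω : DForm (𝓡 (2 * (n + 1))) X 2}
  {𝓔 : Ends.{u} Ω} {L₀ L₁ : Set X} {Λ₀ Λ₁ : ∀ j, Set (𝓔.MNeg j)} {u : ℝ × ℝ → X}
  {J : TimeDependentEndo n X}

/-- A closed subset of a convex end without points of `L₀ ∩ L₁` contains no asymptotics of a
pseudo-holomorphic strip. -/
theorem IsPseudoholomorphicStrip.eventually_notMem
    (hu : IsPseudoholomorphicStrip 𝓔 L₀ L₁ Λ₀ Λ₁ u J) {C : Set X} (hC : IsClosed C) (i : 𝓔.Pos)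
    (hCi : C ⊆ (𝓔.convex i).chart.target) (hCL : Disjoint (L₀ ∩ L₁) C) :
    (∀ᶠ z in atBot ×ˢ 𝓟 (Icc 0 1), u z ∉ C) ∧ ∀ᶠ z in atTop ×ˢ 𝓟 (Icc 0 1), u z ∉ C := by
  have hpt {s : Filter ℝ} (h : ∃ p ∈ L₀ ∩ L₁, TendstoPoint u s p) :
      ∀ᶠ z in s ×ˢ 𝓟 (Icc 0 1), u z ∉ C := by
    obtain ⟨p, hp, h⟩ := h
    exact h (hC.isOpen_compl.mem_nhds (disjoint_left.1 hCL hp))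
  have hch {s : Filter ℝ} {j : 𝓔.Neg} {c : ℝ → 𝓔.MNeg j}
      (h : (𝓔.concave j).TendstoCurve u s c) : ∀ᶠ z in s ×ˢ 𝓟 (Icc 0 1), u z ∉ C := by
    filter_upwards [h.eventually_mem] with z hz hzC
    exact disjoint_left.1 (𝓔.disjoint j i) hz (hCi hzC)
  rcases hu.asymptotics with ⟨h, h'⟩ | ⟨⟨_, _, _, _, h⟩, h'⟩ | ⟨h, _, _, _, _, h'⟩ |
    ⟨⟨_, _, _, _, h⟩, _, _, _, _, h'⟩
  · exact ⟨hpt h, hpt h'⟩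
  · exact ⟨hch h, hpt h'⟩
  · exact ⟨hpt h, hch h'⟩
  · exact ⟨hch h, hch h'⟩

/-- The asymptotics are uniform in `t`, so the preimage of `C` has bounded `τ`; it is closed because
the strip and `C` are. -/
theorem IsPseudoholomorphicStrip.isCompact_preimage
    (hu : IsPseudoholomorphicStrip 𝓔 L₀ L₁ Λ₀ Λ₁ u J) {C : Set X} (hC : IsClosed C) (i : 𝓔.Pos)
    (hCi : C ⊆ (𝓔.convex i).chart.target) (hCL : Disjoint (L₀ ∩ L₁) C) :
    IsCompact (strip ∩ u ⁻¹' C) := by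
  obtain ⟨hb, ht⟩ := hu.eventually_notMem hC i hCi hCL
  rw [eventually_prod_principal_iff] at hb ht
  obtain ⟨a, ha⟩ := eventually_atBot.1 hb
  obtain ⟨b, hb⟩ := eventually_atTop.1 ht
  refine (isCompact_Icc.prod isCompact_Icc : IsCompact (Icc a b ×ˢ Icc (0 : ℝ) 1)).of_isClosed_subset
    (hu.smooth.continuousOn.preimage_isClosed_of_isClosed isClosed_strip hC) ?_
  rintro ⟨τ, t⟩ ⟨hz, hzC⟩
  refine ⟨⟨?_, ?_⟩, hz.2⟩
  · by_contra! h
    exact ha τ h.le t hz.2 hzC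
  · by_contra! h
    exact hb τ h.le t hz.2 hzC

end Asymptotics

end FloerEnds

/-! ### The lemma -/

open FloerEnds in
theorem lemma5p1 {n : ℕ} {X : Type*} [TopologicalSpace X] [T2Space X]
    [ChartedSpace (EuclideanSpace ℝ (Fin (2 * (n + 1)))) X]
    [IsManifold (𝓡 (2 * (n + 1))) ∞ X]
    (Ω : DForm (𝓡 (2 * (n + 1))) X 2) (hΩ : Ω.IsSymplectic)
    -- the ends of `X`
    (𝓔 : Ends Ω)
    -- transverse Lagrangian submanifolds, cylindrical on the concave ends
    (L₀ L₁ : Set X) (hL₀ : IsLagrangian Ω L₀) (hL₁ : IsLagrangian Ω L₁)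
    (hL : Transversal (2 * (n + 1)) L₀ L₁)
    (Λ₀ Λ₁ : ∀ j, Set (𝓔.MNeg j))
    (hΛ₀ : ∀ j, (𝓔.MNeg j).IsLegendrian (Λ₀ j)) (hΛ₁ : ∀ j, (𝓔.MNeg j).IsLegendrian (Λ₁ j))
    (hLΛ₀ : ∀ j, (𝓔.concave j).IsCylinderOver L₀ (Λ₀ j))
    (hLΛ₁ : ∀ j, (𝓔.concave j).IsCylinderOver L₁ (Λ₁ j))
    -- time-dependent almost complex structures
    (J : TimeDependentEndo n X) (hJ : IsCompatibleFamily Ω J)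
    -- a convex end on which the Lagrangians and the almost complex structures are cylindrical
    (i : 𝓔.Pos) (Λ₀' Λ₁' : Set (𝓔.MPos i))
    (hΛ₀' : (𝓔.MPos i).IsLegendrian Λ₀') (hΛ₁' : (𝓔.MPos i).IsLegendrian Λ₁')
    (hLΛ₀' : (𝓔.convex i).IsCylinderOver L₀ Λ₀') (hLΛ₁' : (𝓔.convex i).IsCylinderOver L₁ Λ₁')
    (hJi : (𝓔.convex i).IsCylindricalFamily J)
    -- a pseudo-holomorphic strip
    (u : ℝ × ℝ → X) (hu : IsPseudoholomorphicStrip 𝓔 L₀ L₁ Λ₀ Λ₁ u J) :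
    u '' strip ⊆ ((𝓔.convex i).chart.target)ᶜ := by
  rintro _ ⟨z₁, hz₁, rfl⟩ hz₁i
  set e := 𝓔.convex i
  have hR : 𝓔.RPos i < e.height u z₁ := by
    have h := e.chart.map_target hz₁i
    rw [e.source_eq] at h
    exact h.1
  -- A level strictly above `R` gives a set `C` closed in all of `X`, not merely in the end.
  obtain ⟨c, hRc, hc⟩ := exists_between hR
  let C : Set X := e.chart '' (Ici c ×ˢ univ)
  have hsub : (Ici c ×ˢ univ : Set (ℝ × 𝓔.MPos i)) ⊆ e.chart.source := by
    rw [e.source_eq]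
    exact prod_mono (fun a ha => hRc.trans_le ha) (subset_univ _)
  have hCt : C ⊆ e.chart.target := by
    rintro _ ⟨p, hp, rfl⟩
    exact e.chart.map_source (hsub hp)
  have hC : IsClosed C := e.isClosed_image_Ici_prod_univ hRc
  have hmemC (z) (hz : u z ∈ e.chart.target) (h : c ≤ e.height u z) : u z ∈ C :=
    ⟨e.chart.symm (u z), ⟨h, mem_univ _⟩, e.chart.right_inv hz⟩
  have hCL : Disjoint (L₀ ∩ L₁) C :=
    (e.disjoint_of_transversal hL hLΛ₀' hLΛ₁' hΛ₀' hΛ₁').mono_right hCt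
  have hcont (z) (hz : z ∈ strip) (hzt : u z ∈ e.chart.target) :
      ContinuousWithinAt (e.height u) strip z :=
    (e.contMDiffWithinAt_height hu.smooth hz hzt).continuousWithinAt
  refine absurd (le_of_subharmonic_neumann (α := e.height u) (c := c)
    (hu.isCompact_preimage hC i hCt hCL) inter_subset_left ?_ ?_ ?_ ?_ z₁
    ⟨hz₁, hmemC z₁ hz₁i hc.le⟩) (not_le.2 hc)
  · exact fun z hz => (hcont z hz.1 (hCt hz.2)).mono inter_subset_left
  · intro z hz hcz
    -- Strict inequality `c < α` persists nearby, so the point is interior to `K` relative to the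
    -- strip.
    filter_upwards [self_mem_nhdsWithin, (hcont z hz.1 (hCt hz.2)) (lt_mem_nhds hcz),
      (hu.smooth.continuousOn z hz.1) (e.chart.open_target.mem_nhds (hCt hz.2))] with w hw h1 h2
    exact ⟨hw, hmemC w h2 h1.le⟩
  · intro z hz _ hzi
    refine ⟨?_, e.laplacian_height_nonneg hJi hu.smooth hu.equation hzi (hCt hz.2)⟩
    have h := (e.contMDiffWithinAt_height hu.smooth hz.1 (hCt hz.2)).contMDiffAt
      (strip_mem_nhds hzi)
    exact (contMDiffAt_iff_contDiffAt.1 h).of_le ENat.LEInfty.out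
  · intro z hz _ hzi
    have hz2 : z.2 = 0 ∨ z.2 = 1 := by
      by_contra! hne
      exact hzi ⟨lt_of_le_of_ne hz.1.2.1 hne.1.symm, lt_of_le_of_ne hz.1.2.2 hne.2⟩
    rcases hz2 with h0 | h1
    · exact e.hasDerivWithinAt_height_zero hJi hu.smooth hu.equation hLΛ₀' hΛ₀' hz.1 (hCt hz.2)
        fun τ => h0 ▸ hu.boundary₀ τ
    · exact e.hasDerivWithinAt_height_zero hJi hu.smooth hu.equation hLΛ₁' hΛ₁' hz.1 (hCt hz.2)
        fun τ => h1 ▸ hu.boundary₁ τ
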